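/- \textbf{Setting.} Let $c_0<c_1<\dots<c_N$ ($N\ge1$), $P=\{(c_{i},c_{i+1}):0\le i<N\}$, and let $T$ be a self-map of $[c_0,c_N]$ which is continuous and strictly monotone on each element of $P$ (a piecewise monotone map $(T,P)$; in particular $P$ may be the natural partition of $T$). The itinerary of $x$ is the sequence $A\in P^{\mathbb N}$ with $T^kx\in A_k$ for all $k\ge0$, when it exists. Let $\Sigma_+=\Sigma_+(T,P)\subset P^{\mathbb N}$ be the closure of the set of all itineraries, let $\Sigma=\Sigma(T,P)=\{A\in P^{\mathbb Z}:\forall p\in\mathbb Z\ A_pA_{p+1}\dots\in\Sigma_+\}$, and let $K(T,P)$ be the set of the one-sided limits of itineraries at $c_0+,c_1-,c_1+,\dots,c_N-$. Write $\sigma$ for the left shift. For a word $w=A_{-n}\dots A_0$ let $\mathrm{fol}(w)=\{B_0B_1\dots\in\Sigma_+:\exists B\in\Sigma,\ B_{-n}\dots B_0=w\}$. The word $w$ is minimal if $n=0$ or $\mathrm{fol}(A_{-n}\dots A_0)\subsetneq\mathrm{fol}(A_{-n+1}\dots A_0)$, and $\min(w)$ is the longest minimal suffix of $w$. The Markov diagram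 is the graph whose vertices are the minimal words occurring in $\Sigma$, with an arrow $A_{-n}\dots A_0\to B_{-m}\dots B_0$ iff $B_{-m}\dots B_0=\min(A_{-n}\dots A_0B_0)$. Let $\widehat\Sigma$ be the set of its bi-infinite paths, with the left shift, and let $\hat\pi:\widehat\Sigma\to\Sigma$ send $\alpha$ to the sequence of the last symbols of the $\alpha_n$. A sequence $A\in\Sigma$ is \emph{Markov at time $p$} if $\mathrm{fol}(A_{p-n}\dots A_p)$ is constant for large $n$; $\Sigma_M$ is the set of $A\in\Sigma$ which are Markov at all times $p\in\mathbb Z$. It is \emph{shadowed by $K(T,P)$ at time $p$} if, for arbitrarily large $n$, $A_{p-n}\dots A_p$ is the beginning of a sequence in $K(T,P)$. \textbf{Theorem (after Hofbauer).} Let $(T,P)$ be a piecewise monotone map. \begin{enumerate} \item $\hat\pi$ is a Borel isomorphism, commuting with the shifts, from $\widehat\Sigma$ onto $\Sigma_M$. Every $\sigma$-invariant probability measure carried by $\Sigma\setminus\Sigma_M$ has zero Kolmogorov--Sinai entropy. Hence $\hat\pi:\widehat\Sigma\to\Sigma$ is an entropy-conjugacy: it is a Borel isomorphism commuting with the shifts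 between invariant Borel subsets of $\widehat\Sigma$ and $\Sigma$ whose complements carry only invariant probability measures of zero entropy. \item $K(T,P)$ is finite and, except for finitely many periodic sequences, a sequence $A\in\Sigma$ is shadowed by $K(T,P)$ at all times if and only if it is non-Markov at all times. \item There is a finite union $E$ of periodic orbits of $\Sigma_+$ such that $\alpha\mapsto(\hat\pi(\alpha)_n)_{n\ge0}$ is a bijection from the set of periodic points of $\widehat\Sigma$ onto the set of periodic points of $\Sigma_+$ not in $E$, and it preserves minimal periods. \end{enumerate} -/

import Mathlib

open Set Filter Topology MeasureTheory

noncomputable section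

/-! ## Measured entropy and entropy-conjugacies -/

/-- Shannon entropy of the finite partition given by the fibres of `f`. -/
def shannonEntropy {X ι : Type*} [MeasurableSpace X] [Fintype ι] (μ : Measure X) (f : X → ι) : ℝ :=
  ∑ i, Real.negMulLog (μ.real (f ⁻¹' {i}))

/-- The `n`-name of `x` with respect to the partition `P`; its fibres are the `P,n`-cylinders. -/
def partitionName {X : Type*} (T : X → X) {k : ℕ} (P : X → Fin k) (n : ℕ) (x : X) : Fin n → Fin k :=
  fun j => P (T^[j] x)

/-- Entropy of `T` with respect to a finite partition: the limit of `H(μ, Pⁿ) / n`.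
The limit exists for invariant probability measures, so the upper limit is that limit. -/
def partitionEntropy {X : Type*} [MeasurableSpace X] (T : X → X) (μ : Measure X)
    {k : ℕ} (P : X → Fin k) : ENNReal :=
  limsup (fun n : ℕ => ENNReal.ofReal (shannonEntropy μ (partitionName T P n) / n)) atTop

/-- Kolmogorov–Sinai entropy: the supremum over all finite measurable partitions. -/
def measuredEntropy {X : Type*} [MeasurableSpace X] (T : X → X) (μ : Measure X) : ENNReal :=
  ⨆ (k : ℕ) (P : X → Fin k) (_ : Measurable P), partitionEntropy T μ P

/-- Every `T`-invariant probability measure carried by `Z` has zero entropy. -/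
def CarriesOnlyZeroEntropy {X : Type*} [MeasurableSpace X] (T : X → X) (Z : Set X) : Prop :=
  ∀ μ : Measure X, IsProbabilityMeasure μ → MeasurePreserving T μ μ → μ Zᶜ = 0 →
    measuredEntropy T μ = 0

/-- `f` restricts to a Borel isomorphism, commuting with the dynamics, between the measurable
invariant sets `X₀` and `Y₀`. -/
structure IsBorelIsomorphismOn {X Y : Type*} [MeasurableSpace X] [MeasurableSpace Y]
    (T : X → X) (S : Y → Y) (f : X → Y) (X₀ : Set X) (Y₀ : Set Y) : Prop where
  measurableSet_source : MeasurableSet X₀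
  measurableSet_target : MeasurableSet Y₀
  source_invariant : T ⁻¹' X₀ = X₀
  target_invariant : S ⁻¹' Y₀ = Y₀
  bijOn : BijOn f X₀ Y₀
  semiconj : ∀ x ∈ X₀, f (T x) = S (f x)
  measurable : Measurable (X₀.domRestrict f)
  measurable_inverse : ∀ E ⊆ X₀, MeasurableSet E → MeasurableSet (f '' E)

/-- `f : X₁ → Y₁` is an entropy-conjugacy: after discarding sets which carry only measures of zero
entropy, it is a Borel isomorphism commuting with the dynamics. -/
def IsEntropyConjugacy {X Y : Type*} [MeasurableSpace X] [MeasurableSpace Y]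
    (T : X → X) (S : Y → Y) (f : X → Y) (X₁ : Set X) (Y₁ : Set Y) : Prop :=
  MapsTo f X₁ Y₁ ∧ ∃ X₀ ⊆ X₁, ∃ Y₀ ⊆ Y₁, IsBorelIsomorphismOn T S f X₀ Y₀ ∧
    CarriesOnlyZeroEntropy T (X₁ \ X₀) ∧ CarriesOnlyZeroEntropy S (Y₁ \ Y₀)

/-! ## Subshifts and the Markov diagram -/

section Subshift

variable {𝒜 : Type*}

/-- The left shift on one-sided sequences. -/
def shiftNat (A : ℕ → 𝒜) : ℕ → 𝒜 := fun n => A (n + 1)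

/-- The left shift on two-sided sequences. -/
def shiftInt (A : ℤ → 𝒜) : ℤ → 𝒜 := fun n => A (n + 1)

/-- The one-sided sequence `A_p A_{p+1} …`. -/
def tailFrom (A : ℤ → 𝒜) (p : ℤ) : ℕ → 𝒜 := fun n => A (p + n)

/-- The natural extension of a one-sided subshift. -/
def naturalExtension (S : Set (ℕ → 𝒜)) : Set (ℤ → 𝒜) := {A | ∀ p : ℤ, tailFrom A p ∈ S}

/-- The word `A_{p-n} … A_p`, as a list. -/
def pastWord (A : ℤ → 𝒜) (p : ℤ) (n : ℕ) : List 𝒜 :=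
  List.ofFn fun j : Fin (n + 1) => A (p - n + (j : ℕ))

/-- The follower set of a word: the list `w` of length `n + 1` is the word `A_{-n} … A_0`, and the
follower set consists of all `B_0 B_1 … ∈ S` which extend to some two-sided `B` in the natural
extension with `B_{-n} … B_0 = w`. -/
def followerSet (S : Set (ℕ → 𝒜)) (w : List 𝒜) : Set (ℕ → 𝒜) :=
  {b | b ∈ S ∧ ∃ B ∈ naturalExtension S, tailFrom B 0 = b ∧
    ∀ (j : ℕ) (hj : j < w.length), B ((j : ℤ) + 1 - (w.length : ℤ)) = w[j]}

/-- `fol(A_{-n} … A_0)` is strictly contained in `fol(A_{-n+1} … A_0)`. Words of length one are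
minimal by convention, so that every nonempty word has a minimal form. -/
def IsMinimalWord (S : Set (ℕ → 𝒜)) (w : List 𝒜) : Prop :=
  w.length = 1 ∨ (2 ≤ w.length ∧ followerSet S w ⊂ followerSet S w.tail)

open Classical in
/-- The minimal form of a word: its longest suffix which is minimal. -/
def minimalForm (S : Set (ℕ → 𝒜)) : List 𝒜 → List 𝒜
  | [] => []
  | a :: w => if IsMinimalWord S (a :: w) then a :: w else minimalForm S w

/-- A vertex of the Markov diagram: a minimal word which occurs in the subshift (a word occurs in
the natural extension exactly when its follower set is nonempty). -/
def IsMarkovVertex (S : Set (ℕ → 𝒜)) (w : List 𝒜) : Prop :=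
  w ≠ [] ∧ IsMinimalWord S w ∧ (followerSet S w).Nonempty

/-- The vertices of the Markov diagram. -/
def MarkovDiagram (S : Set (ℕ → 𝒜)) : Type _ := {w : List 𝒜 // IsMarkovVertex S w}

/-- The set of vertices is discrete. -/
instance (S : Set (ℕ → 𝒜)) : MeasurableSpace (MarkovDiagram S) := ⊤

/-- The last symbol of a vertex. -/
def MarkovDiagram.lastSymbol {S : Set (ℕ → 𝒜)} (v : MarkovDiagram S) : 𝒜 :=
  v.1.getLast v.2.1

/-- The arrows of the Markov diagram: `A_{-n} … A_0 → B_{-m} … B_0` if and only if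
`B_{-m} … B_0 = min(A_{-n} … A_0 B_0)`. -/
def MarkovDiagram.Arrow {S : Set (ℕ → 𝒜)} (v w : MarkovDiagram S) : Prop :=
  w.1 = minimalForm S (v.1 ++ [w.lastSymbol])

/-- The Hofbauer shift: two-sided paths on the Markov diagram. -/
def hofbauerShift (S : Set (ℕ → 𝒜)) : Set (ℤ → MarkovDiagram S) :=
  {α | ∀ p : ℤ, (α p).Arrow (α (p + 1))}

/-- The natural projection from the Hofbauer shift. -/
def hofbauerProj (S : Set (ℕ → 𝒜)) (α : ℤ → MarkovDiagram S) : ℤ → 𝒜 :=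
  fun n => (α n).lastSymbol

/-- `A` is (eventually) Markov at time `p`. -/
def IsMarkovAt (S : Set (ℕ → 𝒜)) (A : ℤ → 𝒜) (p : ℤ) : Prop :=
  ∃ N : ℕ, ∀ n ≥ N, followerSet S (pastWord A p n) = followerSet S (pastWord A p N)

/-- The eventually Markov part of the natural extension. -/
def markovPart (S : Set (ℕ → 𝒜)) : Set (ℤ → 𝒜) :=
  {A | A ∈ naturalExtension S ∧ ∀ p : ℤ, IsMarkovAt S A p}

/-- `A` is shadowed by `K` at time `p`: for arbitrarily large `n`, the word `A_{p-n} … A_p` is the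
beginning of a sequence in `K`. -/
def IsShadowedAt (K : Set (ℕ → 𝒜)) (A : ℤ → 𝒜) (p : ℤ) : Prop :=
  ∀ m : ℕ, ∃ n ≥ m, ∃ B ∈ K, ∀ j ≤ n, A (p - n + j) = B j

end Subshift

/-! ## Piecewise monotone maps -/

section PiecewiseMonotone

variable {N : ℕ}

/-- The open interval `(c_i, c_{i+1})`. -/
def piece (c : Fin (N + 1) → ℝ) (i : Fin N) : Set ℝ := Ioo (c i.castSucc) (c i.succ)

/-- `(T, P)` is a piecewise monotone map: `P` consists of the intervals `(c_i, c_{i+1})`, where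
`c_0 < c_1 < ⋯ < c_N`, and `T` is a self-map of `[c_0, c_N]`, continuous and strictly monotone on
each element of `P`. There is no condition on the values of `T` at the points `c_i`. -/
structure IsPiecewiseMonotone (T : ℝ → ℝ) (c : Fin (N + 1) → ℝ) : Prop where
  pos : 0 < N
  strictMono : StrictMono c
  mapsTo : MapsTo T (Icc (c 0) (c (Fin.last N))) (Icc (c 0) (c (Fin.last N)))
  continuousOn : ∀ i, ContinuousOn T (piece c i)
  monotone : ∀ i, StrictMonoOn T (piece c i) ∨ StrictAntiOn T (piece c i)

/-- `A` is the itinerary of `x`. -/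
def IsItinerary (T : ℝ → ℝ) (c : Fin (N + 1) → ℝ) (x : ℝ) (A : ℕ → Fin N) : Prop :=
  ∀ k : ℕ, T^[k] x ∈ piece c (A k)

/-- The symbolic dynamics `Σ_+(T, P)`: the closure of the set of all itineraries, for the product of
the discrete topologies. -/
def symbolicDynamics (T : ℝ → ℝ) (c : Fin (N + 1) → ℝ) : Set (ℕ → Fin N) :=
  closure {A | ∃ x ∈ Icc (c 0) (c (Fin.last N)), IsItinerary T c x A}

/-- `A` is the limit of the itineraries of `y` as `y` tends to a point along `l`: for each `k`, the
symbol of index `k` is eventually equal to `A k`. -/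
def IsLimitItinerary (T : ℝ → ℝ) (c : Fin (N + 1) → ℝ) (l : Filter ℝ) (A : ℕ → Fin N) : Prop :=
  ∀ k : ℕ, ∀ᶠ y in l, T^[k] y ∈ piece c (A k)

/-- The set `K(T, P)` of kneading invariants: the itineraries of `c_0+, c_1-, c_1+, …, c_N-`. -/
def kneadingSet (T : ℝ → ℝ) (c : Fin (N + 1) → ℝ) : Set (ℕ → Fin N) :=
  {A | ∃ i : Fin N, IsLimitItinerary T c (𝓝[>] (c i.castSucc)) A ∨
    IsLimitItinerary T c (𝓝[<] (c i.succ)) A}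

end PiecewiseMonotone

end

/-! Coding. The follower set of `w a` depends only on `a` and on the follower set of `w`
(`followerSet_concat`), and taking minimal forms preserves follower sets. Along a path of the
diagram, the vertex at time `p` is therefore the minimal form of every long enough past word of the
projected sequence. Hence the projection is injective with Markov image; conversely, the stable
minimal forms of the pasts of a sequence in the Markov part form a path.

Shadowing. If a symbol can precede one sequence but not another one with a long common prefix, an
interval sticks out of the image of a monotone branch; then it covers a whole end of that image, and
the kneading sequence at the corresponding endpoint shares the prefix
(`IsPiecewiseMonotone.exists_kneading_prefix`). Each strict drop of the follower sets along a past
thus produces a kneading prefix, so non-Markov times are shadowed. Conversely, at a time both Markov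
and shadowed, several shifts of one kneading sequence are interchangeable after its prefixes. Each
of them is then extreme among the others on the line, so among any three two coincide and the past
is periodic. A sequence shadowed at all times and Markov at one is hence periodic, and has a tail in
the finite kneading set: there are finitely many of these.

Entropy. An invariant measure on the non-Markov part gives measure zero to being Markov at time `0`,
so almost every sequence is shadowed by a finite set. Up to a small proportion of positions, it is
then cut into long prefixes of finitely many sequences, and is described by few labels per unit of
time; a coding bound (`shannonEntropy_le_of_decoder`) gives zero entropy.

Periodic points. Injectivity of the projection transports periods, and periodic non-Markov sequences
are finitely many by shadowing. -/

section SymbolicDynamics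

variable {𝒜 : Type*}

/-! ### Shifts, tails and splicing -/

/-- The inverse of the left shift on two-sided sequences. -/
def unshiftInt (A : ℤ → 𝒜) : ℤ → 𝒜 := fun n => A (n - 1)

/-- The sequence whose coordinates before time `0` are those of `A` before time `p`, and which
continues with `b` from time `0` on. -/
def splice (A : ℤ → 𝒜) (p : ℤ) (b : ℕ → 𝒜) : ℤ → 𝒜 :=
  fun i => if i < 0 then A (p + i) else b i.toNat

theorem tailFrom_shiftInt (A : ℤ → 𝒜) (p : ℤ) : tailFrom (shiftInt A) p = tailFrom A (p + 1) := by
  ext n; simp only [tailFrom, shiftInt]; congr 1; ring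

theorem tailFrom_unshiftInt (A : ℤ → 𝒜) (p : ℤ) :
    tailFrom (unshiftInt A) p = tailFrom A (p - 1) := by
  ext n; simp only [tailFrom, unshiftInt]; congr 1; ring

theorem shiftNat_tailFrom (A : ℤ → 𝒜) (p : ℤ) : shiftNat (tailFrom A p) = tailFrom A (p + 1) := by
  ext n; simp only [tailFrom, shiftNat]; congr 1; push_cast; ring

theorem shiftInt_iterate (n : ℕ) (A : ℤ → 𝒜) (i : ℤ) : shiftInt^[n] A i = A (i + n) := by
  induction n generalizing A i with
  | zero => simp
  | succ n ih =>
    rw [Function.iterate_succ_apply, ih]; simp only [shiftInt]; congr 1; push_cast; ring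

theorem shiftNat_iterate (n : ℕ) (A : ℕ → 𝒜) (i : ℕ) : shiftNat^[n] A i = A (i + n) := by
  induction n generalizing A i with
  | zero => simp
  | succ n ih =>
    rw [Function.iterate_succ_apply, ih]; rfl

theorem shiftNat_iterate_tailFrom (A : ℤ → 𝒜) (p : ℤ) (n : ℕ) :
    shiftNat^[n] (tailFrom A p) = tailFrom A (p + n) := by
  ext i; rw [shiftNat_iterate]; simp only [tailFrom]; congr 1; push_cast; ring

theorem tailFrom_splice_zero (A : ℤ → 𝒜) (p : ℤ) (b : ℕ → 𝒜) : tailFrom (splice A p b) 0 = b := by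
  ext n; simp [tailFrom, splice]

variable {S : Set (ℕ → 𝒜)}

theorem shiftInt_mem_naturalExtension_iff {A : ℤ → 𝒜} :
    shiftInt A ∈ naturalExtension S ↔ A ∈ naturalExtension S := by
  simp only [naturalExtension, mem_ofPred_eq, tailFrom_shiftInt]
  exact ⟨fun h p => by simpa using h (p - 1), fun h p => h _⟩

theorem unshiftInt_mem_naturalExtension {A : ℤ → 𝒜} (hA : A ∈ naturalExtension S) :
    unshiftInt A ∈ naturalExtension S := fun p => by
  rw [tailFrom_unshiftInt]; exact hA _

/-! ### Words and follower sets -/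

/-- The word `w` is `B_{-n} … B_0`, where `n + 1` is its length. -/
def EndsAt (B : ℤ → 𝒜) (w : List 𝒜) : Prop :=
  ∀ (j : ℕ) (hj : j < w.length), B ((j : ℤ) + 1 - (w.length : ℤ)) = w[j]

theorem mem_followerSet {w : List 𝒜} {b : ℕ → 𝒜} :
    b ∈ followerSet S w ↔ ∃ B ∈ naturalExtension S, tailFrom B 0 = b ∧ EndsAt B w :=
  ⟨fun h => h.2, fun h => ⟨by obtain ⟨B, hB, rfl, -⟩ := h; exact hB 0, h⟩⟩

theorem EndsAt.of_suffix {B : ℤ → 𝒜} {v w : List 𝒜} (hw : EndsAt B w) (h : v <:+ w) :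
    EndsAt B v := by
  obtain ⟨u, rfl⟩ := h
  intro j hj
  have := hw (u.length + j) (by simp; omega)
  rw [List.getElem_append_right (by omega)] at this
  simp only [add_tsub_cancel_left] at this
  rw [← this]
  congr 1
  simp only [List.length_append]; push_cast; ring

theorem endsAt_concat {B : ℤ → 𝒜} {w : List 𝒜} {a : 𝒜} :
    EndsAt B (w ++ [a]) ↔ B 0 = a ∧ EndsAt (unshiftInt B) w := by
  constructor
  · intro h
    refine ⟨?_, fun j hj => ?_⟩
    · have := h w.length (by simp)
      simpa using this
    · have := h j (by simp; omega)
      rw [List.getElem_append_left hj] at this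
      rw [← this]; simp only [unshiftInt]; congr 1; simp; ring
  · rintro ⟨h0, h⟩ j hj
    simp only [List.length_append, List.length_singleton] at hj
    rcases Nat.lt_or_ge j w.length with hj' | hj'
    · rw [List.getElem_append_left hj', ← h j hj']
      simp only [unshiftInt]; congr 1; simp; ring
    · obtain rfl : j = w.length := by omega
      simpa using h0

theorem length_pastWord (A : ℤ → 𝒜) (p : ℤ) (n : ℕ) : (pastWord A p n).length = n + 1 := by
  simp [pastWord]

theorem endsAt_pastWord {A B : ℤ → 𝒜} {p : ℤ} {n : ℕ} :
    EndsAt B (pastWord A p n) ↔ ∀ i ≤ n, B (-(i : ℤ)) = A (p - i) := by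
  constructor
  · intro h i hi
    have := h (n - i) (by rw [length_pastWord]; omega)
    simp only [pastWord, List.getElem_ofFn, List.length_ofFn] at this
    convert this using 2 <;> push_cast [hi] <;> ring
  · intro h j hj
    have hj' : j ≤ n := by rw [length_pastWord] at hj; omega
    have := h (n - j) (by omega)
    simp only [pastWord, List.getElem_ofFn, List.length_ofFn]
    convert this using 2 <;> push_cast [hj'] <;> ring

theorem pastWord_succ (A : ℤ → 𝒜) (p : ℤ) (n : ℕ) :
    pastWord A p (n + 1) = A (p - (n + 1)) :: pastWord A p n := by
  simp only [pastWord]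
  rw [List.ofFn_succ]
  congr 1
  · simp
  · congr 1; ext j; congr 1; simp; ring

theorem pastWord_concat (A : ℤ → 𝒜) (p : ℤ) (n : ℕ) :
    pastWord A p (n + 1) = pastWord A (p - 1) n ++ [A p] := by
  simp only [pastWord]
  rw [List.ofFn_succ_last]
  congr 1
  · congr 1; ext j; congr 1; simp; ring
  · simp

theorem pastWord_zero (A : ℤ → 𝒜) (p : ℤ) : pastWord A p 0 = [A p] := by simp [pastWord]

theorem pastWord_ne_nil (A : ℤ → 𝒜) (p : ℤ) (n : ℕ) : pastWord A p n ≠ [] := by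
  rw [← List.length_pos_iff, length_pastWord]; omega

theorem pastWord_suffix (A : ℤ → 𝒜) (p : ℤ) {m n : ℕ} (h : m ≤ n) :
    pastWord A p m <:+ pastWord A p n := by
  induction n, h using Nat.le_induction with
  | base => exact List.suffix_rfl
  | succ n _ ih => rw [pastWord_succ]; exact ih.trans (List.suffix_cons _ _)

theorem getLast_pastWord (A : ℤ → 𝒜) (p : ℤ) (n : ℕ) :
    (pastWord A p n).getLast (pastWord_ne_nil A p n) = A p := by
  simp only [List.getLast_eq_getElem, pastWord, List.getElem_ofFn, List.length_ofFn]
  congr 1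
  push_cast [Nat.add_sub_cancel]
  ring

theorem followerSet_subset_of_suffix {v w : List 𝒜} (h : v <:+ w) :
    followerSet S w ⊆ followerSet S v := fun b hb => by
  rw [mem_followerSet] at hb ⊢
  obtain ⟨B, hB, hb, hw⟩ := hb
  exact ⟨B, hB, hb, hw.of_suffix h⟩

/-- The past `w` enters only through its follower set: this is what makes the diagram Markov. -/
theorem followerSet_concat (w : List 𝒜) (a : 𝒜) :
    followerSet S (w ++ [a]) = {b | b 0 = a ∧ ∃ b' ∈ followerSet S w, shiftNat b' = b} := by
  ext b
  simp only [mem_followerSet, mem_ofPred_eq, endsAt_concat]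
  constructor
  · rintro ⟨B, hB, rfl, h0, hw⟩
    refine ⟨by simpa [tailFrom] using h0, _, ⟨_, unshiftInt_mem_naturalExtension hB, rfl, hw⟩, ?_⟩
    rw [shiftNat_tailFrom, tailFrom_unshiftInt]; simp
  · rintro ⟨h0, b', ⟨B, hB, rfl, hw⟩, rfl⟩
    refine ⟨shiftInt B, shiftInt_mem_naturalExtension_iff.2 hB, ?_, ?_, ?_⟩
    · rw [shiftNat_tailFrom, tailFrom_shiftInt]
    · simpa [shiftNat, tailFrom, shiftInt] using h0
    · convert hw using 1; ext i; simp [unshiftInt, shiftInt]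

theorem followerSet_concat_congr {v w : List 𝒜} (h : followerSet S v = followerSet S w) (a : 𝒜) :
    followerSet S (v ++ [a]) = followerSet S (w ++ [a]) := by
  rw [followerSet_concat, followerSet_concat, h]

/-! ### Minimal forms -/

theorem minimalForm_suffix (S : Set (ℕ → 𝒜)) (w : List 𝒜) : minimalForm S w <:+ w := by
  induction w with
  | nil => exact List.suffix_rfl
  | cons a w ih =>
    rw [minimalForm]; split_ifs
    · exact List.suffix_rfl
    · exact ih.trans (List.suffix_cons _ _)

theorem followerSet_tail_of_not_isMinimalWord {a : 𝒜} {w : List 𝒜}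
    (h : ¬ IsMinimalWord S (a :: w)) : w ≠ [] ∧ followerSet S (a :: w) = followerSet S w := by
  simp only [IsMinimalWord, not_or, not_and, List.length_cons, List.tail_cons] at h
  have hw : w ≠ [] := by rintro rfl; simp at h
  refine ⟨hw, ?_⟩
  have := h.2 (by have := List.length_pos_iff.2 hw; omega)
  by_contra hne
  exact this ((followerSet_subset_of_suffix (List.suffix_cons a w)).ssubset_of_ne hne)

theorem followerSet_minimalForm (S : Set (ℕ → 𝒜)) (w : List 𝒜) :
    followerSet S (minimalForm S w) = followerSet S w := by
  induction w with
  | nil => rfl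
  | cons a w ih =>
    rw [minimalForm]; split_ifs with h
    · rfl
    · rw [ih, (followerSet_tail_of_not_isMinimalWord h).2]

theorem minimalForm_ne_nil_and_isMinimalWord {w : List 𝒜} (hw : w ≠ []) :
    minimalForm S w ≠ [] ∧ IsMinimalWord S (minimalForm S w) := by
  induction w with
  | nil => exact absurd rfl hw
  | cons a w ih =>
    rw [minimalForm]; split_ifs with h
    · exact ⟨by simp, h⟩
    · exact ih (followerSet_tail_of_not_isMinimalWord h).1

/-- A minimal suffix with the same follower set is the minimal form. -/
theorem minimalForm_eq_of_suffix {v w : List 𝒜} (hv : v ≠ []) (hmin : IsMinimalWord S v)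
    (h : v <:+ w) (hfol : followerSet S w = followerSet S v) : minimalForm S w = v := by
  induction w with
  | nil => exact absurd (List.suffix_nil.1 h) hv
  | cons a w ih =>
    rcases List.suffix_cons_iff.1 h with rfl | h'
    · rw [minimalForm, if_pos hmin]
    · have h1 := followerSet_subset_of_suffix (S := S) (List.suffix_cons a w)
      have h2 := followerSet_subset_of_suffix (S := S) h'
      have heq : followerSet S w = followerSet S v := h2.antisymm (hfol ▸ h1)
      have hw : 1 ≤ w.length := (List.length_pos_iff.2 hv).trans_le h'.length_le
      have : ¬ IsMinimalWord S (a :: w) := by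
        rintro (h3 | ⟨-, h3⟩)
        · simp at h3; simp [h3] at hw
        · exact h3.ne (hfol.trans heq.symm)
      rw [minimalForm, if_neg this]
      exact ih h' heq

/-! ### Markov times -/

theorem followerSet_pastWord_antitone (S : Set (ℕ → 𝒜)) (A : ℤ → 𝒜) (p : ℤ) :
    Antitone fun n => followerSet S (pastWord A p n) :=
  fun _ _ h => followerSet_subset_of_suffix (pastWord_suffix A p h)

/-- Once follower sets of past words have stabilized, appending the same next symbol keeps them
equal. -/
theorem IsMarkovAt.succ {A : ℤ → 𝒜} {p : ℤ} (h : IsMarkovAt S A p) : IsMarkovAt S A (p + 1) := by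
  obtain ⟨N, hN⟩ := h
  refine ⟨N + 1, fun n hn => ?_⟩
  obtain ⟨n, rfl⟩ : ∃ k, n = k + 1 := ⟨n - 1, by omega⟩
  rw [pastWord_concat, pastWord_concat, add_sub_cancel_right]
  exact followerSet_concat_congr (hN n (by omega)) _

theorem IsMarkovAt.mono {A : ℤ → 𝒜} {p q : ℤ} (h : IsMarkovAt S A p) (hpq : p ≤ q) :
    IsMarkovAt S A q := by
  induction q, hpq using Int.leInduction with
  | base => exact h
  | succ q _ ih => exact ih.succ

theorem pastWord_shiftInt (A : ℤ → 𝒜) (p : ℤ) (n : ℕ) :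
    pastWord (shiftInt A) p n = pastWord A (p + 1) n := by
  simp only [pastWord, shiftInt]; congr 1; ext j; congr 1; ring

theorem isMarkovAt_shiftInt {A : ℤ → 𝒜} {p : ℤ} :
    IsMarkovAt S (shiftInt A) p ↔ IsMarkovAt S A (p + 1) := by
  simp only [IsMarkovAt, pastWord_shiftInt]

theorem shiftInt_preimage_markovPart (S : Set (ℕ → 𝒜)) :
    shiftInt ⁻¹' markovPart S = markovPart S := by
  ext A
  simp only [markovPart, mem_preimage, mem_ofPred_eq, shiftInt_mem_naturalExtension_iff,
    isMarkovAt_shiftInt]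
  exact and_congr_right fun _ => ⟨fun h p => by simpa using h (p - 1), fun h p => h _⟩

theorem shiftInt_preimage_hofbauerShift (S : Set (ℕ → 𝒜)) :
    shiftInt ⁻¹' hofbauerShift S = hofbauerShift S := by
  ext α
  simp only [hofbauerShift, mem_preimage, mem_ofPred_eq, shiftInt]
  exact ⟨fun h p => by simpa using h (p - 1), fun h p => h _⟩

/-! ### Paths on the Markov diagram -/

theorem MarkovDiagram.exists_eq_append (v : MarkovDiagram S) : ∃ u, v.1 = u ++ [v.lastSymbol] :=
  ⟨v.1.dropLast, (List.dropLast_append_getLast v.2.1).symm⟩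

/-- The word `u` is the vertex at time `p - n` followed by the next `n` last symbols. Each arrow
only deletes a prefix without changing the follower set, so `u` retains the follower set of the
current vertex. Having a common extension makes the vertex and the past word comparable as suffixes.
-/
theorem hofbauerShift_exists_common_extension {α : ℤ → MarkovDiagram S} (hα : α ∈ hofbauerShift S)
    (p : ℤ) (n : ℕ) : ∃ u, pastWord (hofbauerProj S α) p n <:+ u ∧ (α p).1 <:+ u ∧
      followerSet S u = followerSet S (α p).1 := by
  induction n generalizing p with
  | zero =>
    refine ⟨(α p).1, ?_, List.suffix_rfl, rfl⟩
    obtain ⟨u, hu⟩ := (α p).exists_eq_append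
    rw [pastWord_zero]; exact ⟨u, hu.symm⟩
  | succ n ih =>
    obtain ⟨u, h1, h2, h3⟩ := ih (p - 1)
    have harr := hα (p - 1)
    rw [sub_add_cancel] at harr
    refine ⟨u ++ [hofbauerProj S α p], ?_, ?_, ?_⟩
    · obtain ⟨t, rfl⟩ := h1
      rw [pastWord_concat]; exact ⟨t, by simp⟩
    · rw [harr]
      refine (minimalForm_suffix S _).trans ?_
      obtain ⟨t, ht⟩ := h2
      exact ⟨t, by rw [← List.append_assoc, ht]; rfl⟩
    · rw [followerSet_concat_congr h3]
      rw [harr, followerSet_minimalForm]; rfl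

theorem hofbauerShift_followerSet_pastWord_nonempty {α : ℤ → MarkovDiagram S}
    (hα : α ∈ hofbauerShift S) (p : ℤ) (n : ℕ) :
    (followerSet S (pastWord (hofbauerProj S α) p n)).Nonempty := by
  obtain ⟨u, h1, -, h3⟩ := hofbauerShift_exists_common_extension hα p n
  exact (h3 ▸ (α p).2.2.2).mono (followerSet_subset_of_suffix h1)

theorem hofbauerShift_followerSet_pastWord {α : ℤ → MarkovDiagram S} (hα : α ∈ hofbauerShift S)
    (p : ℤ) {n : ℕ} (hn : (α p).1.length ≤ n + 1) :
    (α p).1 <:+ pastWord (hofbauerProj S α) p n ∧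
      followerSet S (pastWord (hofbauerProj S α) p n) = followerSet S (α p).1 := by
  obtain ⟨u, h1, h2, h3⟩ := hofbauerShift_exists_common_extension hα p n
  have h4 := List.suffix_of_suffix_length_le h2 h1 (by rwa [length_pastWord])
  exact ⟨h4, (followerSet_subset_of_suffix h4).antisymm
    (h3 ▸ followerSet_subset_of_suffix h1)⟩

theorem isMarkovAt_hofbauerProj {α : ℤ → MarkovDiagram S} (hα : α ∈ hofbauerShift S) (p : ℤ) :
    IsMarkovAt S (hofbauerProj S α) p :=
  ⟨(α p).1.length, fun n hn => by
    rw [(hofbauerShift_followerSet_pastWord hα p (by omega)).2,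
      (hofbauerShift_followerSet_pastWord hα p (by omega)).2]⟩

/-- Recovers the path from its projection, whence injectivity. -/
theorem minimalForm_pastWord_hofbauerProj {α : ℤ → MarkovDiagram S} (hα : α ∈ hofbauerShift S)
    (p : ℤ) {n : ℕ} (hn : (α p).1.length ≤ n + 1) :
    minimalForm S (pastWord (hofbauerProj S α) p n) = (α p).1 :=
  have h := hofbauerShift_followerSet_pastWord hα p hn
  minimalForm_eq_of_suffix (α p).2.1 (α p).2.2.1 h.1 h.2

theorem hofbauerProj_injOn (S : Set (ℕ → 𝒜)) : InjOn (hofbauerProj S) (hofbauerShift S) := by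
  intro α hα β hβ h
  ext p : 1
  apply Subtype.ext
  have h1 := minimalForm_pastWord_hofbauerProj hα p
    (n := max (α p).1.length (β p).1.length) (by omega)
  have h2 := minimalForm_pastWord_hofbauerProj hβ p
    (n := max (α p).1.length (β p).1.length) (by omega)
  exact h1.symm.trans (by rw [h, h2])

/-- The vertices are the minimal forms of past words long enough for the follower set to be stable;
they do not depend on the length chosen. -/
theorem exists_hofbauerProj_eq {A : ℤ → 𝒜} (hA : A ∈ markovPart S) :
    ∃ α ∈ hofbauerShift S, hofbauerProj S α = A := by
  choose N hN using hA.2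
  set v : ℤ → List 𝒜 := fun p => minimalForm S (pastWord A p (N p)) with hv
  have hv0 : ∀ p, v p ≠ [] ∧ IsMinimalWord S (v p) := fun p =>
    minimalForm_ne_nil_and_isMinimalWord (pastWord_ne_nil _ _ _)
  have hvs : ∀ p n, N p ≤ n → v p <:+ pastWord A p n := fun p n hn =>
    (minimalForm_suffix S _).trans (pastWord_suffix A p hn)
  have hvf : ∀ p n, N p ≤ n → followerSet S (pastWord A p n) = followerSet S (v p) :=
    fun p n hn => by rw [hN p n hn, hv]; exact (followerSet_minimalForm S _).symm
  have hvm : ∀ p n, N p ≤ n → minimalForm S (pastWord A p n) = v p := fun p n hn =>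
    minimalForm_eq_of_suffix (hv0 p).1 (hv0 p).2 (hvs p n hn) (hvf p n hn)
  have hne : ∀ p, (followerSet S (v p)).Nonempty := fun p => by
    rw [← hvf p _ le_rfl]
    refine ⟨tailFrom A p, mem_followerSet.2 ⟨fun i => A (p + i), fun q => ?_, ?_, ?_⟩⟩
    · convert hA.1 (p + q) using 1; ext n; simp [tailFrom]; ring_nf
    · ext n; simp [tailFrom]
    · rw [endsAt_pastWord]; intro i _; congr 1
  let α : ℤ → MarkovDiagram S := fun p => ⟨v p, (hv0 p).1, (hv0 p).2, hne p⟩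
  have hlast : ∀ p, (α p).lastSymbol = A p := fun p => by
    rw [MarkovDiagram.lastSymbol]
    rw [← getLast_pastWord A p (N p)]
    exact (hvs p _ le_rfl).getLast _
  refine ⟨α, fun p => ?_, funext hlast⟩
  rw [MarkovDiagram.Arrow, hlast]
  change v (p + 1) = minimalForm S (v p ++ [A (p + 1)])
  set n := max (N p) (N (p + 1)) with hn
  have hpw : pastWord A (p + 1) (n + 1) = pastWord A p n ++ [A (p + 1)] := by
    rw [pastWord_concat, add_sub_cancel_right]
  rw [← hvm (p + 1) (n + 1) (by omega), hpw]
  -- The minimal form of `v p` followed by the next symbol is a minimal suffix of the long past word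
  -- with the same follower set, so it is the minimal form of that word.
  have h0 := minimalForm_ne_nil_and_isMinimalWord (S := S) (w := v p ++ [A (p + 1)]) (by simp)
  refine minimalForm_eq_of_suffix h0.1 h0.2 ((minimalForm_suffix S _).trans ?_) ?_
  · obtain ⟨t, ht⟩ := hvs p n (by omega)
    exact ⟨t, by rw [← ht, List.append_assoc]⟩
  · rw [followerSet_minimalForm]
    exact followerSet_concat_congr (hvf p n (by omega)) _

/-! ### Closed subshifts and the bijection onto the Markov part -/

theorem isClosed_naturalExtension [TopologicalSpace 𝒜] (hS : IsClosed S) : IsClosed (naturalExtension S) := by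
  have : naturalExtension S = ⋂ p : ℤ, (fun A => tailFrom A p) ⁻¹' S := by
    ext; simp [naturalExtension]
  rw [this]
  refine isClosed_iInter fun p => hS.preimage ?_
  exact continuous_pi fun n => continuous_apply _

variable [TopologicalSpace 𝒜] [DiscreteTopology 𝒜]

theorem mem_closure_iff_forall_prefix {S : Set (ℕ → 𝒜)} {A : ℕ → 𝒜} :
    A ∈ closure S ↔ ∀ n, ∃ B ∈ S, ∀ k ≤ n, B k = A k := by
  rw [(PiNat.isTopologicalBasis_cylinders (fun _ => 𝒜)).mem_closure_iff]
  constructor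
  · intro h n
    obtain ⟨B, hB, hBS⟩ := h (PiNat.cylinder A (n + 1)) ⟨A, n + 1, rfl⟩ (PiNat.self_mem_cylinder _ _)
    exact ⟨B, hBS, fun k hk => hB k (by omega)⟩
  · rintro h _ ⟨x, n, rfl⟩ hA
    obtain ⟨B, hB, hBA⟩ := h n
    exact ⟨B, fun k hk => by rw [hBA k hk.le]; exact hA k hk, hB⟩

/-- Every finite word of the projection has a nonempty follower set, hence occurs in the natural
extension; closedness does the rest. -/
theorem hofbauerProj_mem_naturalExtension (hS : IsClosed S) {α : ℤ → MarkovDiagram S}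
    (hα : α ∈ hofbauerShift S) : hofbauerProj S α ∈ naturalExtension S := by
  intro q
  refine hS.closure_subset (mem_closure_iff_forall_prefix.2 fun n => ?_)
  obtain ⟨b, hb⟩ := hofbauerShift_followerSet_pastWord_nonempty hα (q + n) n
  obtain ⟨B, hB, -, hw⟩ := mem_followerSet.1 hb
  refine ⟨tailFrom B (-n), hB _, fun k hk => ?_⟩
  have := endsAt_pastWord.1 hw (n - k) (by omega)
  simp only [tailFrom]
  convert this using 2 <;> push_cast [hk] <;> ring

theorem hofbauerProj_bijOn (hS : IsClosed S) :
    BijOn (hofbauerProj S) (hofbauerShift S) (markovPart S) :=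
  ⟨fun _ hα => ⟨hofbauerProj_mem_naturalExtension hS hα, isMarkovAt_hofbauerProj hα⟩,
    hofbauerProj_injOn S, fun _ hA => exists_hofbauerProj_eq hA⟩

/-- Over a finite alphabet, the set of all tails of elements of the natural extension is closed. -/
theorem exists_mem_naturalExtension_tailFrom [Finite 𝒜] (hS : IsClosed S) {κ : ℕ → 𝒜}
    (h : ∀ n, ∃ B ∈ naturalExtension S, ∀ k : ℕ, k ≤ n → B k = κ k) :
    ∃ B ∈ naturalExtension S, tailFrom B 0 = κ := by
  have hc : IsCompact ((fun A => tailFrom A 0) '' naturalExtension S) :=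
    (isClosed_naturalExtension hS).isCompact.image (continuous_pi fun n => continuous_apply _)
  have : κ ∈ closure ((fun A => tailFrom A 0) '' naturalExtension S) := by
    rw [mem_closure_iff_forall_prefix]
    intro n
    obtain ⟨B, hB, hk⟩ := h n
    exact ⟨_, ⟨B, hB, rfl⟩, fun k hk' => by simpa [tailFrom] using hk k hk'⟩
  rwa [hc.isClosed.closure_eq] at this

end SymbolicDynamics

/-! ### Measurability of the projection and of the Markov part -/

section Measurability

variable {𝒜 : Type*} {S : Set (ℕ → 𝒜)}

instance [Countable 𝒜] : Countable (MarkovDiagram S) := Subtype.countable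

instance : DiscreteMeasurableSpace (MarkovDiagram S) := ⟨fun _ => trivial⟩

/-- A set determined by finitely many coordinates is measurable. -/
theorem measurableSet_of_finite_coordinates [MeasurableSpace 𝒜] [DiscreteMeasurableSpace 𝒜]
    [Countable 𝒜] {G : Set (ℤ → 𝒜)} (s : Finset ℤ)
    (h : ∀ x y : ℤ → 𝒜, (∀ i ∈ s, x i = y i) → x ∈ G → y ∈ G) : MeasurableSet G := by
  have : G = s.restrict ⁻¹' (s.restrict '' G) := by
    refine (subset_preimage_image _ _).antisymm ?_
    rintro y ⟨x, hx, hxy⟩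
    exact h x y (fun i hi => congrFun hxy ⟨i, hi⟩) hx
  rw [this]
  exact (Finset.measurable_restrict s) (MeasurableSet.of_discrete)

theorem measurableSet_hofbauerShift [Countable 𝒜] : MeasurableSet (hofbauerShift S) := by
  have : hofbauerShift S = ⋂ p : ℤ, (fun α : ℤ → MarkovDiagram S => (α p, α (p + 1))) ⁻¹'
      {v | v.1.Arrow v.2} := by
    ext; simp [hofbauerShift]
  rw [this]
  exact MeasurableSet.iInter fun p =>
    ((measurable_pi_apply _).prodMk (measurable_pi_apply _)) (MeasurableSet.of_discrete)

theorem measurable_hofbauerProj [MeasurableSpace 𝒜] : Measurable (hofbauerProj S) :=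
  measurable_pi_lambda _ fun n => (Measurable.of_discrete
    (f := fun v : MarkovDiagram S => v.lastSymbol)).comp (measurable_pi_apply n)

theorem pastWord_congr {A B : ℤ → 𝒜} {p : ℤ} {n : ℕ}
    (h : ∀ i ∈ Finset.Icc (p - n) p, A i = B i) : pastWord A p n = pastWord B p n := by
  simp only [pastWord]
  congr 1; ext j
  refine h _ ?_
  rw [Finset.mem_Icc]
  have := j.2
  constructor <;> omega

/-- Each equality of follower sets involves only finitely many coordinates of `A`. -/
theorem measurableSet_isMarkovAt [MeasurableSpace 𝒜] [DiscreteMeasurableSpace 𝒜] [Countable 𝒜]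
    (S : Set (ℕ → 𝒜)) (p : ℤ) : MeasurableSet {A | IsMarkovAt S A p} := by
  have : {A | IsMarkovAt S A p} = ⋃ N : ℕ, ⋂ n : ℕ, ⋂ _ : N ≤ n,
      {A | followerSet S (pastWord A p n) = followerSet S (pastWord A p N)} := by
    ext; simp [IsMarkovAt]
  rw [this]
  refine MeasurableSet.iUnion fun N => MeasurableSet.iInter fun n => MeasurableSet.iInter fun hn =>
    measurableSet_of_finite_coordinates (Finset.Icc (p - n) p) fun x y hxy hx => ?_
  have h1 := pastWord_congr hxy
  have h2 := pastWord_congr (A := x) (B := y) (p := p) (n := N) fun i hi => hxy i (by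
    rw [Finset.mem_Icc] at hi ⊢; omega)
  rw [mem_ofPred_eq] at hx ⊢
  rwa [← h1, ← h2]

theorem measurableSet_markovPart [TopologicalSpace 𝒜] [DiscreteTopology 𝒜] [MeasurableSpace 𝒜]
    [BorelSpace 𝒜] [Countable 𝒜] (hS : IsClosed S) : MeasurableSet (markovPart S) := by
  have : markovPart S = naturalExtension S ∩ ⋂ p : ℤ, {A | IsMarkovAt S A p} := by
    ext; simp [markovPart]
  rw [this]
  exact (isClosed_naturalExtension hS).measurableSet.inter
    (MeasurableSet.iInter fun p => measurableSet_isMarkovAt S p)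

theorem isBorelIsomorphismOn_hofbauerProj [TopologicalSpace 𝒜] [DiscreteTopology 𝒜]
    [MeasurableSpace 𝒜] [BorelSpace 𝒜] [Countable 𝒜] (hS : IsClosed S) :
    IsBorelIsomorphismOn shiftInt shiftInt (hofbauerProj S) (hofbauerShift S) (markovPart S) where
  measurableSet_source := measurableSet_hofbauerShift
  measurableSet_target := measurableSet_markovPart hS
  source_invariant := shiftInt_preimage_hofbauerShift S
  target_invariant := shiftInt_preimage_markovPart S
  bijOn := hofbauerProj_bijOn hS
  semiconj _ _ := rfl
  measurable := measurable_hofbauerProj.comp measurable_subtype_coe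
  -- Lusin–Souslin: an injective Borel map on a standard Borel space sends Borel sets to Borel sets.
  measurable_inverse _ hE hmeas :=
    hmeas.image_of_measurable_injOn measurable_hofbauerProj ((hofbauerProj_injOn S).mono hE)

theorem carriesOnlyZeroEntropy_empty {X : Type*} [MeasurableSpace X] (T : X → X) :
    CarriesOnlyZeroEntropy T ∅ := fun μ _ _ h => by simp at h

end Measurability

/-! ### Ordered sets of reals -/

/-- Disjoint order-connected sets are linearly arranged. -/
theorem lt_of_disjoint_ordConnected {α : Type*} [LinearOrder α] {I J : Set α}
    (hI : I.OrdConnected) (hJ : J.OrdConnected) (hd : Disjoint I J) {a b a' b' : α} (ha : a ∈ I)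
    (hb : b ∈ J) (hab : a < b) (ha' : a' ∈ I) (hb' : b' ∈ J) : a' < b' := by
  by_contra! h
  rcases le_or_gt b a' with h1 | h1
  · exact disjoint_left.1 hd (hI.out ha ha' ⟨hab.le, h1⟩) hb
  · exact disjoint_left.1 hd ha' (hJ.out hb' hb ⟨h, h1.le⟩)

/-- Among three pairwise disjoint order-connected sets, one lies between the others. -/
theorem false_of_three_extreme {α : Type*} [LinearOrder α] {I J K : Set α}
    (hI : I.OrdConnected) (hJ : J.OrdConnected) (hK : K.OrdConnected)
    (hIJ : Disjoint I J) (hJK : Disjoint J K) (hIK : Disjoint I K)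
    (h1 : ∃ a ∈ I, ∃ b ∈ J, ∃ c ∈ K, (a ≤ b ∧ a ≤ c) ∨ (b ≤ a ∧ c ≤ a))
    (h2 : ∃ a ∈ I, ∃ b ∈ J, ∃ c ∈ K, (b ≤ a ∧ b ≤ c) ∨ (a ≤ b ∧ c ≤ b))
    (h3 : ∃ a ∈ I, ∃ b ∈ J, ∃ c ∈ K, (c ≤ a ∧ c ≤ b) ∨ (a ≤ c ∧ b ≤ c)) : False := by
  obtain ⟨a, ha, b, hb, c, hc, h1⟩ := h1
  obtain ⟨a', ha', b', hb', c', hc', h2⟩ := h2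
  obtain ⟨a'', ha'', b'', hb'', c'', hc'', h3⟩ := h3
  have key : ∀ {I J : Set α}, I.OrdConnected → J.OrdConnected → Disjoint I J →
      (∀ x ∈ I, ∀ y ∈ J, x < y) ∨ (∀ x ∈ I, ∀ y ∈ J, y < x) := by
    intro I J hI hJ hd
    by_cases h : ∃ x ∈ I, ∃ y ∈ J, x < y
    · obtain ⟨x, hx, y, hy, hxy⟩ := h
      exact Or.inl fun x' hx' y' hy' => lt_of_disjoint_ordConnected hI hJ hd hx hy hxy hx' hy'
    · push Not at h
      exact Or.inr fun x hx y hy =>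
        (h x hx y hy).lt_of_ne fun e => disjoint_left.1 hd hx (e ▸ hy)
  rcases key hI hJ hIJ with k1 | k1 <;> rcases key hJ hK hJK with k2 | k2 <;>
    rcases key hI hK hIK with k3 | k3
  · exact h2.elim (fun h => (k1 a' ha' b' hb').not_ge h.1) fun h => (k2 b' hb' c' hc').not_ge h.2
  · exact ((k1 a ha b hb).trans (k2 b hb c hc)).not_gt (k3 a ha c hc)
  · exact h3.elim (fun h => (k3 a'' ha'' c'' hc'').not_ge h.1)
      fun h => (k2 b'' hb'' c'' hc'').not_ge h.2
  · exact h1.elim (fun h => (k3 a ha c hc).not_ge h.2) fun h => (k1 a ha b hb).not_ge h.1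
  · exact h1.elim (fun h => (k1 a ha b hb).not_ge h.1) fun h => (k3 a ha c hc).not_ge h.2
  · exact h3.elim (fun h => (k2 b'' hb'' c'' hc'').not_ge h.2)
      fun h => (k3 a'' ha'' c'' hc'').not_ge h.1
  · exact ((k2 b hb c hc).trans (k1 a ha b hb)).not_gt (k3 a ha c hc)
  · exact h2.elim (fun h => (k2 b' hb' c' hc').not_ge h.2) fun h => (k1 a' ha' b' hb').not_ge h.1

/-- Points of `J` outside `I` on both sides of a common point enclose `I`, forcing `I ⊆ J`. -/
theorem false_of_ordConnected_cut {α : Type*} [LinearOrder α] {I J : Set α}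
    (hI : I.OrdConnected) (hJ : J.OrdConnected) {p q r y : α} (hpI : p ∈ I) (hpJ : p ∈ J)
    (hyI : y ∈ I) (hyJ : y ∉ J) (hqJ : q ∈ J) (hqI : q ∉ I) (hrJ : r ∈ J) (hrI : r ∉ I)
    (hqp : q ≤ p) (hpr : p ≤ r) : False := by
  rcases le_total y p with h | h
  · rcases le_total y q with h' | h'
    · exact hqI (hI.out hyI hpI ⟨h', hqp⟩)
    · exact hyJ (hJ.out hqJ hpJ ⟨h', h⟩)
  · rcases le_total y r with h' | h'
    · exact hyJ (hJ.out hpJ hrJ ⟨h, h'⟩)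
    · exact hrI (hI.out hpI hyI ⟨hpr, h'⟩)

theorem ordConnected_preimage_of_monotoneOn_or_antitoneOn {f : ℝ → ℝ} {s t : Set ℝ}
    (hs : s.OrdConnected) (ht : t.OrdConnected) (hf : MonotoneOn f s ∨ AntitoneOn f s) :
    (s ∩ f ⁻¹' t).OrdConnected := by
  refine ⟨fun x hx y hy z hz => ?_⟩
  have hzs := hs.out hx.1 hy.1 hz
  refine ⟨hzs, ?_⟩
  rcases hf with hf | hf
  · exact ht.out hx.2 hy.2 ⟨hf hx.1 hzs hz.1, hf hzs hy.1 hz.2⟩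
  · exact ht.out hy.2 hx.2 ⟨hf hzs hy.1 hz.2, hf hx.1 hzs hz.1⟩

theorem StrictMonoOn.exists_tendsto_nhdsGT {f : ℝ → ℝ} {a b m M : ℝ} (hab : a < b)
    (hf : StrictMonoOn f (Ioo a b)) (hm : MapsTo f (Ioo a b) (Icc m M)) :
    ∃ L ∈ Ico m M, Tendsto f (𝓝[>] a) (𝓝[>] L) := by
  have hne : (f '' Ioo a b).Nonempty := (nonempty_Ioo.2 hab).image f
  have hbdd : BddBelow (f '' Ioo a b) := ⟨m, by rintro _ ⟨x, hx, rfl⟩; exact (hm hx).1⟩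
  have hlt : ∀ x ∈ Ioo a b, sInf (f '' Ioo a b) < f x := fun x hx => by
    obtain ⟨z, hz1, hz2⟩ := exists_between hx.1
    have hz : z ∈ Ioo a b := ⟨hz1, hz2.trans hx.2⟩
    exact (csInf_le hbdd ⟨z, hz, rfl⟩).trans_lt (hf hz hx hz2)
  obtain ⟨x₀, hx₀⟩ := nonempty_Ioo.2 hab
  refine ⟨sInf (f '' Ioo a b), ⟨le_csInf hne ?_, (hlt x₀ hx₀).trans_le (hm hx₀).2⟩, ?_⟩
  · rintro _ ⟨x, hx, rfl⟩; exact (hm hx).1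
  · refine (nhdsGT_basis _).tendsto_right_iff.2 fun u hu => ?_
    obtain ⟨_, ⟨x, hx, rfl⟩, hxu⟩ := exists_lt_of_csInf_lt hne hu
    filter_upwards [Ioo_mem_nhdsGT hx.1] with y hy
    have hy' : y ∈ Ioo a b := ⟨hy.1, hy.2.trans hx.2⟩
    exact ⟨hlt y hy', (hf hy' hx hy.2).trans hxu⟩

theorem StrictMonoOn.exists_tendsto_nhdsLT {f : ℝ → ℝ} {a b m M : ℝ} (hab : a < b)
    (hf : StrictMonoOn f (Ioo a b)) (hm : MapsTo f (Ioo a b) (Icc m M)) :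
    ∃ L ∈ Ioc m M, Tendsto f (𝓝[<] b) (𝓝[<] L) := by
  have hne : (f '' Ioo a b).Nonempty := (nonempty_Ioo.2 hab).image f
  have hbdd : BddAbove (f '' Ioo a b) := ⟨M, by rintro _ ⟨x, hx, rfl⟩; exact (hm hx).2⟩
  have hlt : ∀ x ∈ Ioo a b, f x < sSup (f '' Ioo a b) := fun x hx => by
    obtain ⟨z, hz1, hz2⟩ := exists_between hx.2
    have hz : z ∈ Ioo a b := ⟨hx.1.trans hz1, hz2⟩
    exact (hf hx hz hz1).trans_le (le_csSup hbdd ⟨z, hz, rfl⟩)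
  obtain ⟨x₀, hx₀⟩ := nonempty_Ioo.2 hab
  refine ⟨sSup (f '' Ioo a b), ⟨(hm hx₀).1.trans_lt (hlt x₀ hx₀), csSup_le hne ?_⟩, ?_⟩
  · rintro _ ⟨x, hx, rfl⟩; exact (hm hx).2
  · refine (nhdsLT_basis _).tendsto_right_iff.2 fun u hu => ?_
    obtain ⟨_, ⟨x, hx, rfl⟩, hxu⟩ := exists_lt_of_lt_csSup hne hu
    filter_upwards [Ioo_mem_nhdsLT hx.2] with y hy
    have hy' : y ∈ Ioo a b := ⟨hx.1.trans hy.1, hy.2⟩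
    exact ⟨hxu.trans (hf hx hy' hy.1), hlt y hy'⟩

section PiecewiseMonotone

variable {N : ℕ} {T : ℝ → ℝ} {c : Fin (N + 1) → ℝ}

/-! ### Pieces and cylinders -/

theorem piece_injective (hc : StrictMono c) {x : ℝ} {i j : Fin N} (hi : x ∈ piece c i)
    (hj : x ∈ piece c j) : i = j := by
  by_contra h
  wlog hij : i < j generalizing i j
  · exact this hj hi (Ne.symm h) (lt_of_le_of_ne (not_lt.1 hij) (Ne.symm h))
  have : c i.succ ≤ c j.castSucc := hc.monotone (by
    rw [Fin.le_def]; simpa using Fin.lt_def.1 hij)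
  exact absurd (hi.2.trans_le (this.trans hj.1.le)) (lt_irrefl _)

theorem piece_subset_Icc (hc : StrictMono c) (i : Fin N) :
    piece c i ⊆ Icc (c 0) (c (Fin.last N)) := fun _ hx =>
  ⟨(hc.monotone (Fin.zero_le _)).trans hx.1.le, hx.2.le.trans (hc.monotone (Fin.le_last _))⟩

/-- The points whose first `n` itinerary symbols are those of `z`. -/
def pointCylinder (T : ℝ → ℝ) (c : Fin (N + 1) → ℝ) (z : ℕ → Fin N) (n : ℕ) : Set ℝ :=
  {x | ∀ k < n, T^[k] x ∈ piece c (z k)}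

theorem pointCylinder_succ (z : ℕ → Fin N) (n : ℕ) : pointCylinder T c z (n + 1) =
    pointCylinder T c z n ∩ T^[n] ⁻¹' piece c (z n) := by
  ext x
  simp only [pointCylinder, mem_ofPred_eq, mem_inter_iff, mem_preimage, Nat.lt_succ_iff_lt_or_eq]
  exact ⟨fun h => ⟨fun k hk => h k (Or.inl hk), h n (Or.inr rfl)⟩, by
    rintro ⟨h1, h2⟩ k (hk | rfl)
    exacts [h1 k hk, h2]⟩

theorem pointCylinder_anti (z : ℕ → Fin N) {m n : ℕ} (h : m ≤ n) :
    pointCylinder T c z n ⊆ pointCylinder T c z m := fun _ hx k hk => hx k (hk.trans_le h)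

theorem iterate_mem_pointCylinder {z : ℕ → Fin N} {n m : ℕ} {x : ℝ}
    (hx : x ∈ pointCylinder T c z (m + n)) : T^[n] x ∈ pointCylinder T c (shiftNat^[n] z) m :=
  fun k hk => by
    rw [← Function.iterate_add_apply, shiftNat_iterate]; exact hx _ (by omega)

theorem disjoint_pointCylinder (hc : StrictMono c) {y z : ℕ → Fin N} {n k : ℕ} (hk : k < n)
    (h : y k ≠ z k) : Disjoint (pointCylinder T c y n) (pointCylinder T c z n) :=
  disjoint_left.2 fun _ hy hz => h (piece_injective hc (hy k hk) (hz k hk))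

theorem IsPiecewiseMonotone.iterate_on_pointCylinder (hT : IsPiecewiseMonotone T c) (z : ℕ → Fin N) (n : ℕ) :
    (pointCylinder T c z n).OrdConnected ∧
      (StrictMonoOn T^[n] (pointCylinder T c z n) ∨
        StrictAntiOn T^[n] (pointCylinder T c z n)) := by
  induction n with
  | zero =>
    have : pointCylinder T c z 0 = univ := by ext; simp [pointCylinder]
    rw [this]
    exact ⟨ordConnected_univ, Or.inl (strictMono_id.strictMonoOn _)⟩
  | succ n ih =>
    obtain ⟨h1, h2⟩ := ih
    have hsub := pointCylinder_anti (T := T) (c := c) z n.le_succ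
    have hmaps : MapsTo T^[n] (pointCylinder T c z (n + 1)) (piece c (z n)) :=
      fun x hx => hx n n.lt_succ_self
    constructor
    · rw [pointCylinder_succ]
      exact ordConnected_preimage_of_monotoneOn_or_antitoneOn h1 ordConnected_Ioo
        (h2.imp StrictMonoOn.monotoneOn StrictAntiOn.antitoneOn)
    · rw [Function.iterate_succ']
      rcases h2 with h2 | h2 <;> rcases hT.monotone (z n) with h3 | h3
      · exact Or.inl (h3.comp (h2.mono hsub) hmaps)
      · exact Or.inr (h3.comp_strictMonoOn (h2.mono hsub) hmaps)
      · exact Or.inr (h3.comp_strictAntiOn (h2.mono hsub) hmaps)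
      · exact Or.inl (h3.comp (h2.mono hsub) hmaps)

/-! ### The symbolic dynamics -/

theorem mem_symbolicDynamics {A : ℕ → Fin N} : A ∈ symbolicDynamics T c ↔
    ∀ n, ∃ x ∈ Icc (c 0) (c (Fin.last N)), ∃ B, IsItinerary T c x B ∧ ∀ k ≤ n, B k = A k := by
  rw [symbolicDynamics, mem_closure_iff_forall_prefix]
  exact forall_congr' fun n => ⟨fun ⟨B, ⟨x, hx, hB⟩, h⟩ => ⟨x, hx, B, hB, h⟩,
    fun ⟨x, hx, B, hB, h⟩ => ⟨B, ⟨x, hx, hB⟩, h⟩⟩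

theorem IsItinerary.shiftNat {x : ℝ} {A : ℕ → Fin N} (h : IsItinerary T c x A) :
    IsItinerary T c (T x) (shiftNat A) := fun k => by
  rw [← Function.iterate_succ_apply]; exact h (k + 1)

theorem IsPiecewiseMonotone.shiftNat_mem_symbolicDynamics (hT : IsPiecewiseMonotone T c)
    {A : ℕ → Fin N} (hA : A ∈ symbolicDynamics T c) : shiftNat A ∈ symbolicDynamics T c := by
  rw [mem_symbolicDynamics] at hA ⊢
  intro n
  obtain ⟨x, hx, B, hB, h⟩ := hA (n + 1)
  exact ⟨T x, hT.mapsTo hx, _, hB.shiftNat, fun k hk => h (k + 1) (by omega)⟩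

theorem isClosed_symbolicDynamics (T : ℝ → ℝ) (c : Fin (N + 1) → ℝ) :
    IsClosed (symbolicDynamics T c) := isClosed_closure

theorem exists_mem_pointCylinder {A : ℕ → Fin N} (hA : A ∈ symbolicDynamics T c) (n : ℕ) :
    (pointCylinder T c A n).Nonempty := by
  obtain ⟨x, -, B, hB, h⟩ := mem_symbolicDynamics.1 hA n
  exact ⟨x, fun k hk => h k hk.le ▸ hB k⟩

/-! ### Kneading sequences -/

/-- A filter of one-sided neighbourhoods inside the domain of a piecewise monotone map. -/
def IsOneSidedFilter (c : Fin (N + 1) → ℝ) (l : Filter ℝ) : Prop :=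
  (∃ d ∈ Ico (c 0) (c (Fin.last N)), l = 𝓝[>] d) ∨ ∃ d ∈ Ioc (c 0) (c (Fin.last N)), l = 𝓝[<] d

theorem exists_Ico_of_mem {d : ℝ} (hd : d ∈ Ico (c 0) (c (Fin.last N))) :
    ∃ i : Fin N, d ∈ Ico (c i.castSucc) (c i.succ) := by
  by_contra! h
  have : ∀ i : Fin (N + 1), c i ≤ d := fun i => by
    induction i using Fin.induction with
    | zero => exact hd.1
    | succ i ih => exact not_lt.1 fun hlt => h i ⟨ih, hlt⟩
  exact absurd hd.2 (not_lt.2 (this _))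

theorem exists_Ioc_of_mem {d : ℝ} (hd : d ∈ Ioc (c 0) (c (Fin.last N))) :
    ∃ i : Fin N, d ∈ Ioc (c i.castSucc) (c i.succ) := by
  by_contra! h
  have : ∀ i : Fin (N + 1), c i < d := fun i => by
    induction i using Fin.induction with
    | zero => exact hd.1
    | succ i ih => exact not_le.1 fun hlt => h i ⟨ih, hlt⟩
  exact absurd hd.2 (not_le.2 (this _))

/-- Strict monotonicity makes the image approach its limit strictly from one side, so one-sided
neighbourhoods can be iterated whatever the values of `T` at the endpoints. Decreasing branches are
treated through `-T`. -/
theorem IsPiecewiseMonotone.exists_tendsto_isOneSidedFilter (hT : IsPiecewiseMonotone T c)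
    {l : Filter ℝ} (hl : IsOneSidedFilter c l) :
    (∃ i, piece c i ∈ l) ∧ ∃ l', IsOneSidedFilter c l' ∧ Tendsto T l l' := by
  have hneg : ∀ i : Fin N, ∀ s ⊆ piece c i,
      MapsTo T s (Icc (c 0) (c (Fin.last N))) ∧
      MapsTo (fun x => -T x) s (Icc (-c (Fin.last N)) (-c 0)) := fun i s hs =>
    have h : MapsTo T s (Icc (c 0) (c (Fin.last N))) := fun x hx =>
      hT.mapsTo (piece_subset_Icc hT.strictMono i (hs hx))
    ⟨h, fun x hx => ⟨neg_le_neg (h hx).2, neg_le_neg (h hx).1⟩⟩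
  rcases hl with ⟨d, hd, rfl⟩ | ⟨d, hd, rfl⟩
  · obtain ⟨i, hi⟩ := exists_Ico_of_mem hd
    refine ⟨⟨i, Ioo_mem_nhdsGT_of_mem hi⟩, ?_⟩
    have hsub : Ioo d (c i.succ) ⊆ piece c i := Ioo_subset_Ioo_left hi.1
    rcases hT.monotone i with h | h
    · obtain ⟨L, hL, hlim⟩ := (h.mono hsub).exists_tendsto_nhdsGT hi.2 (hneg i _ hsub).1
      exact ⟨_, Or.inl ⟨L, hL, rfl⟩, hlim⟩
    · obtain ⟨L, hL, hlim⟩ := StrictMonoOn.exists_tendsto_nhdsGT (f := fun x => -T x) hi.2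
        (fun x hx y hy hxy => neg_lt_neg (h (hsub hx) (hsub hy) hxy)) (hneg i _ hsub).2
      refine ⟨_, Or.inr ⟨-L, ⟨by linarith [hL.2], by linarith [hL.1]⟩, rfl⟩, ?_⟩
      simpa [Function.comp_def] using (tendsto_neg_nhdsGT (a := L)).comp hlim
  · obtain ⟨i, hi⟩ := exists_Ioc_of_mem hd
    refine ⟨⟨i, Ioo_mem_nhdsLT_of_mem hi⟩, ?_⟩
    have hsub : Ioo (c i.castSucc) d ⊆ piece c i := Ioo_subset_Ioo_right hi.2
    rcases hT.monotone i with h | h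
    · obtain ⟨L, hL, hlim⟩ := (h.mono hsub).exists_tendsto_nhdsLT hi.1 (hneg i _ hsub).1
      exact ⟨_, Or.inr ⟨L, hL, rfl⟩, hlim⟩
    · obtain ⟨L, hL, hlim⟩ := StrictMonoOn.exists_tendsto_nhdsLT (f := fun x => -T x) hi.1
        (fun x hx y hy hxy => neg_lt_neg (h (hsub hx) (hsub hy) hxy)) (hneg i _ hsub).2
      refine ⟨_, Or.inl ⟨-L, ⟨by linarith [hL.2], by linarith [hL.1]⟩, rfl⟩, ?_⟩
      simpa [Function.comp_def] using (tendsto_neg_nhdsLT (a := L)).comp hlim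

theorem IsPiecewiseMonotone.exists_isLimitItinerary (hT : IsPiecewiseMonotone T c)
    {l : Filter ℝ} (hl : IsOneSidedFilter c l) : ∃ A, IsLimitItinerary T c l A := by
  have h : ∀ k : ℕ, ∃ l', IsOneSidedFilter c l' ∧ Tendsto T^[k] l l' := fun k => by
    induction k with
    | zero => exact ⟨l, hl, tendsto_id⟩
    | succ k ih =>
      obtain ⟨l', hl', hlim⟩ := ih
      obtain ⟨l'', hl'', hlim'⟩ := (hT.exists_tendsto_isOneSidedFilter hl').2
      exact ⟨l'', hl'', by rw [Function.iterate_succ']; exact hlim'.comp hlim⟩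
  have h' : ∀ k : ℕ, ∃ i, ∀ᶠ y in l, T^[k] y ∈ piece c i := fun k => by
    obtain ⟨l', hl', hlim⟩ := h k
    obtain ⟨i, hi⟩ := (hT.exists_tendsto_isOneSidedFilter hl').1
    exact ⟨i, hlim hi⟩
  choose A hA using h'
  exact ⟨A, hA⟩

theorem isOneSidedFilter_left (hc : StrictMono c) (i : Fin N) :
    IsOneSidedFilter c (𝓝[>] (c i.castSucc)) :=
  Or.inl ⟨_, ⟨hc.monotone (Fin.zero_le _), hc (Fin.castSucc_lt_last i)⟩, rfl⟩

theorem isOneSidedFilter_right (hc : StrictMono c) (i : Fin N) :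
    IsOneSidedFilter c (𝓝[<] (c i.succ)) :=
  Or.inr ⟨_, ⟨hc (Fin.succ_pos i), hc.monotone (Fin.le_last _)⟩, rfl⟩

theorem IsLimitItinerary.eq_of_eventually (hc : StrictMono c) {l : Filter ℝ} [l.NeBot]
    {A : ℕ → Fin N} (hA : IsLimitItinerary T c l A) {k : ℕ} {i : Fin N}
    (h : ∀ᶠ y in l, T^[k] y ∈ piece c i) : A k = i := by
  obtain ⟨y, h1, h2⟩ := ((hA k).and h).exists
  exact piece_injective hc h1 h2

theorem IsPiecewiseMonotone.finite_kneadingSet (hT : IsPiecewiseMonotone T c) :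
    (kneadingSet T c).Finite := by
  have hsub : ∀ l : Filter ℝ, l.NeBot → {A | IsLimitItinerary T c l A}.Subsingleton :=
    fun l hl A hA B hB => funext fun k => hA.eq_of_eventually hT.strictMono (hB k)
  have : kneadingSet T c = ⋃ i : Fin N, ({A | IsLimitItinerary T c (𝓝[>] (c i.castSucc)) A} ∪
      {A | IsLimitItinerary T c (𝓝[<] (c i.succ)) A}) := by
    ext; simp [kneadingSet]
  rw [this]
  exact finite_iUnion fun i => (hsub _ inferInstance).finite.union (hsub _ inferInstance).finite

/-- If prepending a symbol to a sequence leaves the symbolic dynamics, while it does not for a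
sequence sharing a long prefix, then a kneading sequence shares that prefix. -/
theorem IsPiecewiseMonotone.exists_kneading_prefix (hT : IsPiecewiseMonotone T c)
    {B C : ℕ → Fin N} {m : ℕ} (hB : B ∉ symbolicDynamics T c)
    (hB' : shiftNat B ∈ symbolicDynamics T c) (hC : C ∈ symbolicDynamics T c)
    (h : ∀ j ≤ m, B j = C j) : ∃ κ ∈ kneadingSet T c, ∀ j ≤ m, κ j = C j := by
  rw [mem_symbolicDynamics] at hB hB' hC
  push Not at hB
  obtain ⟨n, hn⟩ := hB
  -- Agreement up to `m` puts `y` in the cylinder `I` below; agreement up to `n` keeps `y` out of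
  -- the image of the first piece, since a preimage there would have an itinerary agreeing with `B`
  -- up to `n`.
  obtain ⟨y, hy, Y, hY, hYB⟩ := hB' (max m n)
  obtain ⟨x, hx, X, hX, hXC⟩ := hC m
  have hx0 : x ∈ piece c (C 0) := hXC 0 (Nat.zero_le _) ▸ hX 0
  have hyT : y ∉ T '' piece c (C 0) := by
    rintro ⟨u, hu, rfl⟩
    obtain ⟨k, hk, hne⟩ := hn u (piece_subset_Icc hT.strictMono _ hu)
      (fun k => Nat.casesOn k (C 0) Y) (fun k => by
        cases k with
        | zero => exact hu
        | succ k => rw [Function.iterate_succ_apply]; exact hY k)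
    cases k with
    | zero => exact hne (h 0 (Nat.zero_le _)).symm
    | succ k => exact hne (hYB k (by omega))
  set I := pointCylinder T c (shiftNat C) m with hI
  have hIo : I.OrdConnected := (hT.iterate_on_pointCylinder _ _).1
  have hyI : y ∈ I := fun k hk => by
    have := hYB k (by omega)
    simp only [shiftNat] at this ⊢
    rw [← h (k + 1) (by omega), ← this]; exact hY k
  have hxI : T x ∈ I := fun k hk => by
    simp only [shiftNat]
    rw [← hXC (k + 1) (by omega), ← Function.iterate_succ_apply]; exact hX (k + 1)
  have hJo : (T '' piece c (C 0)).OrdConnected :=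
    (isPreconnected_Ioo.image T (hT.continuousOn _)).ordConnected
  have hcyl : ∀ u ∈ piece c (C 0), T u ∈ I → ∀ j ≤ m, T^[j] u ∈ piece c (C j) := by
    intro u hu hTu j hj
    cases j with
    | zero => exact hu
    | succ j => rw [Function.iterate_succ_apply]; exact hTu j hj
  -- The interval `I` meets the image of the piece at `T x` and leaves it at `y`, so it cannot be
  -- bounded inside that image on both sides of `T x`. The piece therefore maps into `I` on one
  -- whole side of `x`, up to the endpoint.
  have hside : (∀ u ∈ piece c (C 0), u < x → T u ∈ I) ∨
      ∀ u ∈ piece c (C 0), x < u → T u ∈ I := by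
    by_contra! hcon
    obtain ⟨⟨u, hu, hux, huI⟩, v, hv, hxv, hvI⟩ := hcon
    rcases hT.monotone (C 0) with hmono | hanti
    · exact false_of_ordConnected_cut hIo hJo hxI (mem_image_of_mem _ hx0) hyI hyT
        (mem_image_of_mem _ hu) huI (mem_image_of_mem _ hv) hvI (hmono hu hx0 hux).le
        (hmono hx0 hv hxv).le
    · exact false_of_ordConnected_cut hIo hJo hxI (mem_image_of_mem _ hx0) hyI hyT
        (mem_image_of_mem _ hv) hvI (mem_image_of_mem _ hu) huI (hanti hx0 hv hxv).le
        (hanti hu hx0 hux).le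
  rcases hside with hs | hs
  · obtain ⟨κ, hκ⟩ := hT.exists_isLimitItinerary (isOneSidedFilter_left hT.strictMono (C 0))
    refine ⟨κ, ⟨C 0, Or.inl hκ⟩, fun j hj => hκ.eq_of_eventually hT.strictMono ?_⟩
    filter_upwards [Ioo_mem_nhdsGT hx0.1] with u hu
    have hu' : u ∈ piece c (C 0) := ⟨hu.1, hu.2.trans hx0.2⟩
    exact hcyl u hu' (hs u hu' hu.2) j hj
  · obtain ⟨κ, hκ⟩ := hT.exists_isLimitItinerary (isOneSidedFilter_right hT.strictMono (C 0))
    refine ⟨κ, ⟨C 0, Or.inr hκ⟩, fun j hj => hκ.eq_of_eventually hT.strictMono ?_⟩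
    filter_upwards [Ioo_mem_nhdsLT hx0.2] with u hu
    have hu' : u ∈ piece c (C 0) := ⟨hx0.1.trans hu.1, hu.2⟩
    exact hcyl u hu' (hs u hu' hu.1) j hj

/-- Images of kneading sequences are extreme. -/
theorem IsPiecewiseMonotone.kneading_extreme (hT : IsPiecewiseMonotone T c) {κ X Y : ℕ → Fin N}
    (hκ : κ ∈ kneadingSet T c) (hX : X ∈ symbolicDynamics T c) (hY : Y ∈ symbolicDynamics T c)
    {n : ℕ} (hXκ : ∀ k ≤ n, X k = κ k) (hYκ : ∀ k ≤ n, Y k = κ k) (m : ℕ) :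
    ∃ a ∈ pointCylinder T c (shiftNat^[n] κ) m, ∃ b ∈ pointCylinder T c (shiftNat^[n] X) m,
      ∃ d ∈ pointCylinder T c (shiftNat^[n] Y) m, (a ≤ b ∧ a ≤ d) ∨ (b ≤ a ∧ d ≤ a) := by
  obtain ⟨x, hx⟩ := exists_mem_pointCylinder hX (m + n + 1)
  obtain ⟨y, hy⟩ := exists_mem_pointCylinder hY (m + n + 1)
  have hx0 : x ∈ piece c (κ 0) := hXκ 0 (Nat.zero_le _) ▸ hx 0 (Nat.succ_pos _)
  have hy0 : y ∈ piece c (κ 0) := hYκ 0 (Nat.zero_le _) ▸ hy 0 (Nat.succ_pos _)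
  have hev : ∀ l : Filter ℝ, IsLimitItinerary T c l κ →
      ∀ᶠ z in l, z ∈ pointCylinder T c κ (m + n + 1) := fun l hl => by
    have := (Set.finite_Iio (m + n + 1)).eventually_all.2 fun k (_ : k ∈ Iio _) => hl k
    filter_upwards [this] with z hz k hk using hz k hk
  -- A point `z` close enough to the endpoint defining `κ` lies beyond both `x` and `y`. Up to
  -- reversal, `T^[n]` preserves this order on the common cylinder.
  have hz : ∃ z ∈ pointCylinder T c κ (m + n + 1), (z ≤ x ∧ z ≤ y) ∨ (x ≤ z ∧ y ≤ z) := by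
    obtain ⟨i, hi | hi⟩ := hκ
    · have hi0 : κ 0 = i := hi.eq_of_eventually (k := 0) hT.strictMono
        (Ioo_mem_nhdsGT (hT.strictMono i.castSucc_lt_succ))
      rw [hi0] at hx0 hy0
      obtain ⟨z, h1, h2⟩ := ((hev _ hi).and (Ioo_mem_nhdsGT (lt_min hx0.1 hy0.1))).exists
      exact ⟨z, h1, Or.inl ⟨h2.2.le.trans (min_le_left _ _), h2.2.le.trans (min_le_right _ _)⟩⟩
    · have hi0 : κ 0 = i := hi.eq_of_eventually (k := 0) hT.strictMono
        (Ioo_mem_nhdsLT (hT.strictMono i.castSucc_lt_succ))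
      rw [hi0] at hx0 hy0
      obtain ⟨z, h1, h2⟩ := ((hev _ hi).and (Ioo_mem_nhdsLT (max_lt hx0.2 hy0.2))).exists
      exact ⟨z, h1, Or.inr ⟨(le_max_left _ _).trans h2.1.le, (le_max_right _ _).trans h2.1.le⟩⟩
  obtain ⟨z, hz, hord⟩ := hz
  refine ⟨_, iterate_mem_pointCylinder (pointCylinder_anti _ (Nat.le_succ _) hz),
    _, iterate_mem_pointCylinder (pointCylinder_anti _ (Nat.le_succ _) hx),
    _, iterate_mem_pointCylinder (pointCylinder_anti _ (Nat.le_succ _) hy), ?_⟩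
  have hz' : z ∈ pointCylinder T c κ n := pointCylinder_anti _ (by omega) hz
  have hx' : x ∈ pointCylinder T c κ n := fun k hk => hXκ k hk.le ▸ hx k (by omega)
  have hy' : y ∈ pointCylinder T c κ n := fun k hk => hYκ k hk.le ▸ hy k (by omega)
  rcases (hT.iterate_on_pointCylinder κ n).2 with h | h
  · have := h.monotoneOn
    exact hord.imp (fun ho => ⟨this hz' hx' ho.1, this hz' hy' ho.2⟩)
      fun ho => ⟨this hx' hz' ho.1, this hy' hz' ho.2⟩
  · have := h.antitoneOn
    exact (hord.imp (fun ho => ⟨this hz' hx' ho.1, this hz' hy' ho.2⟩)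
      fun ho => ⟨this hx' hz' ho.1, this hy' hz' ho.2⟩).symm

/-- Three images of a kneading sequence, each reachable along the pasts of the others, are not
pairwise distinct. -/
theorem IsPiecewiseMonotone.not_pairwise_ne_of_kneading (hT : IsPiecewiseMonotone T c)
    {κ : ℕ → Fin N} (hκ : κ ∈ kneadingSet T c) (n : Fin 3 → ℕ)
    (h : ∀ i j, ∃ X ∈ symbolicDynamics T c, (∀ k ≤ n i, X k = κ k) ∧
      shiftNat^[n i] X = shiftNat^[n j] κ) :
    ∃ i j, i ≠ j ∧ shiftNat^[n i] κ = shiftNat^[n j] κ := by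
  by_contra! hne
  have hdiff : ∀ i j, ∃ k, i ≠ j → shiftNat^[n i] κ k ≠ shiftNat^[n j] κ k := fun i j => by
    by_cases hij : i = j
    · exact ⟨0, fun h => absurd hij h⟩
    · obtain ⟨k, hk⟩ := Function.ne_iff.1 (hne i j hij)
      exact ⟨k, fun _ => hk⟩
  choose k hk using hdiff
  set m := Finset.univ.sup (fun p : Fin 3 × Fin 3 => k p.1 p.2) + 1 with hm
  have hkm : ∀ i j, k i j < m := fun i j =>
    Nat.lt_succ_of_le (Finset.le_sup (f := fun p : Fin 3 × Fin 3 => k p.1 p.2)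
      (Finset.mem_univ (i, j)))
  have hd : ∀ i j, i ≠ j → Disjoint (pointCylinder T c (shiftNat^[n i] κ) m)
      (pointCylinder T c (shiftNat^[n j] κ) m) := fun i j hij =>
    disjoint_pointCylinder hT.strictMono (hkm i j) (hk i j hij)
  -- The hypothesis lets the other two shifts follow the prefix of `κ` of index `n i`, so
  -- `kneading_extreme` applies to every choice of extreme cylinder.
  have hext : ∀ i j l, ∃ a ∈ pointCylinder T c (shiftNat^[n i] κ) m,
      ∃ b ∈ pointCylinder T c (shiftNat^[n j] κ) m,
      ∃ d ∈ pointCylinder T c (shiftNat^[n l] κ) m, (a ≤ b ∧ a ≤ d) ∨ (b ≤ a ∧ d ≤ a) := by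
    intro i j l
    obtain ⟨X, hX, hXκ, hXj⟩ := h i j
    obtain ⟨Y, hY, hYκ, hYl⟩ := h i l
    rw [← hXj, ← hYl]
    exact hT.kneading_extreme hκ hX hY hXκ hYκ m
  have ho := fun i => (hT.iterate_on_pointCylinder (shiftNat^[n i] κ) m).1
  refine false_of_three_extreme (ho 0) (ho 1) (ho 2) (hd 0 1 (by decide)) (hd 1 2 (by decide))
    (hd 0 2 (by decide)) (hext 0 1 2) ?_ ?_
  · obtain ⟨b, hb, a, ha, d, hd, h⟩ := hext 1 0 2
    exact ⟨a, ha, b, hb, d, hd, h⟩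
  · obtain ⟨d, hd, a, ha, b, hb, h⟩ := hext 2 0 1
    exact ⟨a, ha, b, hb, d, hd, h⟩

end PiecewiseMonotone

/-! ### Periodic sequences and their tails -/

section Periodic

variable {𝒜 : Type*} {S K : Set (ℕ → 𝒜)}

theorem translate_mem_naturalExtension {A : ℤ → 𝒜} (hA : A ∈ naturalExtension S) (p : ℤ) :
    (fun i => A (p + i)) ∈ naturalExtension S := fun q => by
  convert hA (p + q) using 1; ext n; simp only [tailFrom]; congr 1; ring

theorem isPeriodicPt_shiftInt_iff {A : ℤ → 𝒜} {n : ℕ} :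
    Function.IsPeriodicPt shiftInt n A ↔ Function.Periodic A (n : ℤ) := by
  rw [Function.IsPeriodicPt, Function.IsFixedPt, funext_iff]
  simp only [shiftInt_iterate, Function.Periodic]

theorem isPeriodicPt_shiftNat_iff {A : ℕ → 𝒜} {n : ℕ} :
    Function.IsPeriodicPt shiftNat n A ↔ Function.Periodic A n := by
  rw [Function.IsPeriodicPt, Function.IsFixedPt, funext_iff]
  simp only [shiftNat_iterate, Function.Periodic]

theorem Function.Periodic.tailFrom_add_mul {A : ℤ → 𝒜} {ρ : ℤ} (h : Function.Periodic A ρ)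
    (p k : ℤ) : tailFrom A (p + k * ρ) = tailFrom A p := by
  ext n
  simp only [tailFrom]
  rw [show p + k * ρ + n = p + n + k * ρ by ring]
  exact h.int_mul k _

theorem tailFrom_mem_periodicPts {A : ℤ → 𝒜} (hA : A ∈ Function.periodicPts shiftInt) (p : ℤ) :
    tailFrom A p ∈ Function.periodicPts shiftNat := by
  obtain ⟨n, hn, h⟩ := hA
  refine ⟨n, hn, ?_⟩
  rw [isPeriodicPt_shiftInt_iff] at h
  rw [Function.IsPeriodicPt, Function.IsFixedPt, shiftNat_iterate_tailFrom]
  simpa using h.tailFrom_add_mul p 1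

/-- A common multiple of the two periods moves any index to a nonnegative one. -/
theorem tailFrom_injOn_periodicPts :
    InjOn (fun A : ℤ → 𝒜 => tailFrom A 0) (Function.periodicPts shiftInt) := by
  rintro A ⟨m, hm, hA⟩ B ⟨n, hn, hB⟩ h
  rw [isPeriodicPt_shiftInt_iff] at hA hB
  ext i
  have h1 := hA.int_mul (n * |i|) i
  have h2 := hB.int_mul (m * |i|) i
  rw [Int.cast_id] at h1 h2
  rw [← h1, ← h2]
  have hm' : (1 : ℤ) ≤ m := by exact_mod_cast hm
  have hn' : (1 : ℤ) ≤ n := by exact_mod_cast hn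
  have hnn : 0 ≤ i + n * |i| * m := by
    have : |i| ≤ n * m * |i| := le_mul_of_one_le_left (abs_nonneg i) (by nlinarith)
    have := neg_abs_le i
    nlinarith
  obtain ⟨k, hk⟩ := Int.eq_ofNat_of_zero_le hnn
  have := congrFun h k
  simp only [tailFrom, zero_add] at this
  rw [hk, this, ← hk]
  congr 1
  ring

theorem exists_periodic_extension (hS : ∀ A ∈ S, shiftNat A ∈ S) {b : ℕ → 𝒜} (hb : b ∈ S)
    (hper : b ∈ Function.periodicPts shiftNat) :
    ∃ A ∈ naturalExtension S, A ∈ Function.periodicPts shiftInt ∧ tailFrom A 0 = b := by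
  obtain ⟨n, hn, h⟩ := hper
  rw [isPeriodicPt_shiftNat_iff] at h
  have hn' : (n : ℤ) ≠ 0 := by exact_mod_cast hn.ne'
  have htail : ∀ p : ℤ, tailFrom (fun i : ℤ => b (i % n).toNat) p =
      shiftNat^[(p % n).toNat] b := fun p => by
    ext k
    rw [shiftNat_iterate, ← h.map_mod_nat]
    simp only [tailFrom]
    congr 1
    zify
    rw [Int.toNat_of_nonneg (Int.emod_nonneg _ hn'), Int.toNat_of_nonneg (Int.emod_nonneg _ hn'),
      Int.add_emod_emod, add_comm]
  refine ⟨fun i => b (i % n).toNat, fun p => ?_, ⟨n, hn, ?_⟩, ?_⟩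
  · rw [htail]
    generalize (p % n).toNat = k
    induction k with
    | zero => exact hb
    | succ k ih => rw [Function.iterate_succ_apply']; exact hS _ ih
  · rw [isPeriodicPt_shiftInt_iff]
    intro i
    simp
  · rw [htail]; simp

theorem finite_orbit_of_mem_periodicPts {α : Type*} {f : α → α} {x : α}
    (hx : x ∈ Function.periodicPts f) : (range fun n => f^[n] x).Finite := by
  refine ((finite_Iio (Function.minimalPeriod f x)).image fun n => f^[n] x).subset ?_
  rintro _ ⟨n, rfl⟩
  exact ⟨n % Function.minimalPeriod f x,
    Nat.mod_lt _ (Function.minimalPeriod_pos_of_mem_periodicPts hx),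
    Function.iterate_mod_minimalPeriod_eq⟩

/-- The periodic elements of the natural extension some tail of which belongs to `K`. -/
def periodicWithTailIn (S K : Set (ℕ → 𝒜)) : Set (ℤ → 𝒜) :=
  {A | A ∈ naturalExtension S ∧ A ∈ Function.periodicPts shiftInt ∧ ∃ s, tailFrom A s ∈ K}

/-- The tail at `0` determines a periodic sequence and lies in the finite orbit of a periodic
element of `K`. -/
theorem finite_periodicWithTailIn (hK : K.Finite) : (periodicWithTailIn S K).Finite := by
  refine Set.Finite.of_finite_image (f := fun A => tailFrom A 0) ?_
    (tailFrom_injOn_periodicPts.mono fun A hA => hA.2.1)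
  refine (Set.Finite.biUnion (hK.inter_of_left (Function.periodicPts shiftNat)) fun κ hκ =>
    finite_orbit_of_mem_periodicPts hκ.2).subset ?_
  rintro _ ⟨A, ⟨-, hper, s, hs⟩, rfl⟩
  refine mem_biUnion ⟨hs, tailFrom_mem_periodicPts hper s⟩ ?_
  obtain ⟨n, hn, h⟩ := hper
  rw [isPeriodicPt_shiftInt_iff] at h
  have hn' : (1 : ℤ) ≤ n := by exact_mod_cast hn
  have hnn : 0 ≤ -s + |s| * n := by nlinarith [le_abs_self s, abs_nonneg s]
  refine ⟨(-s + |s| * n).toNat, ?_⟩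
  simp only [shiftNat_iterate_tailFrom, Int.toNat_of_nonneg hnn]
  rw [show s + (-s + |s| * n) = 0 + |s| * n by ring]
  exact h.tailFrom_add_mul 0 _

theorem IsShadowedAt.exists_infinite (hK : K.Finite) {A : ℤ → 𝒜} {p : ℤ}
    (h : IsShadowedAt K A p) :
    ∃ κ ∈ K, {n : ℕ | ∀ j : ℕ, j ≤ n → A (p - n + j) = κ j}.Infinite := by
  by_contra! hcon
  obtain ⟨m, hm⟩ := (hK.biUnion hcon).bddAbove
  obtain ⟨n, hn, B, hB, hj⟩ := h (m + 1)
  have := hm (mem_biUnion hB hj)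
  omega

/-- Infinitely many shadowing lengths share one residue `r` modulo the period; by periodicity, all
these words are prefixes of the tail from `p - r`, which thus equals the shadowing sequence. -/
theorem IsShadowedAt.exists_tailFrom_mem (hK : K.Finite) {A : ℤ → 𝒜} {p : ℤ}
    (h : IsShadowedAt K A p) (hA : A ∈ Function.periodicPts shiftInt) : ∃ s, tailFrom A s ∈ K := by
  obtain ⟨κ, hκ, hinf⟩ := h.exists_infinite hK
  obtain ⟨ρ, hρ, hA⟩ := hA
  rw [isPeriodicPt_shiftInt_iff] at hA
  have : ∃ r ∈ Iio ρ, {n : ℕ | (∀ j : ℕ, j ≤ n → A (p - n + j) = κ j) ∧ n % ρ = r}.Infinite := by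
    by_contra! hcon
    refine hinf (((finite_Iio ρ).biUnion hcon).subset fun n hn => ?_)
    exact mem_biUnion (mem_Iio.2 (Nat.mod_lt n hρ)) ⟨hn, rfl⟩
  obtain ⟨r, -, hr⟩ := this
  refine ⟨p - r, ?_⟩
  convert hκ
  ext j
  obtain ⟨n, ⟨hn, hnr⟩, hjn⟩ := hr.exists_gt j
  rw [← hn j hjn.le]
  have hdiv := Nat.mod_add_div n ρ
  rw [hnr] at hdiv
  have h1 := hA.tailFrom_add_mul (p - r) (-(n / ρ : ℕ))
  rw [← h1]
  simp only [tailFrom]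
  congr 2
  rw [← hdiv]
  push_cast [hnr]
  have : (((r : ℤ) + ρ * (n / ρ : ℕ)) : ℤ) = n := by exact_mod_cast hdiv
  push_cast at this
  rw [this]
  linarith

end Periodic

/-! ### Shadowing versus the Markov property -/

section Shadowing

variable {N : ℕ} {T : ℝ → ℝ} {c : Fin (N + 1) → ℝ}

/-- Sequences which are not Markov are shadowed by the kneading sequences. -/
theorem IsPiecewiseMonotone.isShadowedAt_of_not_isMarkovAt (hT : IsPiecewiseMonotone T c)
    {A : ℤ → Fin N} (hA : A ∈ naturalExtension (symbolicDynamics T c)) {p : ℤ}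
    (h : ¬ IsMarkovAt (symbolicDynamics T c) A p) : IsShadowedAt (kneadingSet T c) A p := by
  set S := symbolicDynamics T c with hS
  intro m
  have hstep : ∃ n ≥ m, ¬ followerSet S (pastWord A p n) ⊆ followerSet S (pastWord A p (n + 1)) := by
    by_contra! hcon
    refine h ⟨m, fun n hn => ?_⟩
    induction n, hn using Nat.le_induction with
    | base => rfl
    | succ n hn ih =>
      rw [← ih]
      exact (followerSet_pastWord_antitone S A p n.le_succ).antisymm (hcon n hn)
  obtain ⟨n, hnm, hsub⟩ := hstep
  obtain ⟨b, hb, hb'⟩ := not_subset.1 hsub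
  obtain ⟨B, hB, hBb, hBw⟩ := mem_followerSet.1 hb
  rw [endsAt_pastWord] at hBw
  -- The continuation `b` is admissible after `A_{p-n} … A_p` but not after one more symbol of the
  -- past; `C` attaches it to the whole past of `A`.
  set C := splice A p b with hC
  have hb0 : b 0 = A p := by
    have := hBw 0 (Nat.zero_le _)
    rw [← hBb]; simpa [tailFrom] using this
  have hCA : ∀ i : ℕ, C (-i) = A (p - i) := fun i => by
    rcases Nat.eq_zero_or_pos i with rfl | hi
    · simp [hC, splice, hb0]
    · simp only [hC, splice]; rw [if_pos (by omega)]; congr 1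
  have hCB : ∀ j : ℤ, -n ≤ j → C j = B j := fun j hj => by
    rcases lt_or_ge j 0 with hj0 | hj0
    · obtain ⟨i, rfl⟩ : ∃ i : ℕ, j = -i := ⟨j.natAbs, by omega⟩
      rw [hCA, hBw i (by omega)]
    · obtain ⟨i, rfl⟩ := Int.eq_ofNat_of_zero_le hj0
      simp [hC, splice, ← hBb, tailFrom]
  have htail : ∀ q : ℤ, -n ≤ q → tailFrom C q ∈ S := fun q hq => by
    convert hB q using 1
    ext j
    exact congrArg _ (hCB _ (by omega))
  have hex : ∃ i : ℕ, tailFrom C (-i) ∉ S := by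
    by_contra! hcon
    refine hb' (mem_followerSet.2 ⟨C, fun q => ?_, tailFrom_splice_zero A p b,
      endsAt_pastWord.2 fun i _ => hCA i⟩)
    rcases le_or_gt (-(n : ℤ)) q with hq | hq
    · exact htail q hq
    · have := hcon q.natAbs
      rwa [show -(q.natAbs : ℤ) = q by omega] at this
  classical
  -- At the first inadmissible tail going backwards, removing one symbol restores admissibility,
  -- while `A` has the same `i + 1` symbols there: this is the setting of `exists_kneading_prefix`.
  obtain ⟨i, hi, hmin⟩ : ∃ i : ℕ, tailFrom C (-i) ∉ S ∧ ∀ k < i, tailFrom C (-k) ∈ S :=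
    ⟨Nat.find hex, Nat.find_spec hex, fun k hk => not_not.1 (Nat.find_min hex hk)⟩
  have hni : n < i := by
    by_contra! hle
    exact hi (htail _ (by omega))
  obtain ⟨κ, hκ, hκj⟩ := hT.exists_kneading_prefix (m := i) (C := tailFrom A (p - i)) hi (by
      rw [shiftNat_tailFrom]
      convert hmin (i - 1) (by omega) using 2
      omega) (hA _) (fun j hj => by
      have := hCA (i - j)
      simp only [tailFrom]
      convert this using 2 <;> omega)
  exact ⟨i, by omega, κ, hκ, fun j hj => (hκj j hj).symm⟩

/-- A sequence which is shadowed and Markov has a periodic past. -/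
theorem IsPiecewiseMonotone.exists_past_period (hT : IsPiecewiseMonotone T c)
    {A : ℤ → Fin N} (hA : A ∈ naturalExtension (symbolicDynamics T c)) {q : ℤ}
    (hM : IsMarkovAt (symbolicDynamics T c) A q) (hsh : IsShadowedAt (kneadingSet T c) A q) :
    ∃ ρ : ℕ, 0 < ρ ∧ ∀ i ≤ q, A (i - ρ) = A i := by
  obtain ⟨κ, hκ, hinf⟩ := hsh.exists_infinite hT.finite_kneadingSet
  set D := {n : ℕ | ∀ j : ℕ, j ≤ n → A (q - n + j) = κ j} with hD
  obtain ⟨B, hB, hBκ⟩ : ∃ B ∈ naturalExtension (symbolicDynamics T c), tailFrom B 0 = κ := by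
    refine exists_mem_naturalExtension_tailFrom (isClosed_symbolicDynamics T c) fun n => ?_
    obtain ⟨n', hn', hlt⟩ := hinf.exists_gt n
    exact ⟨_, translate_mem_naturalExtension hA (q - n'), fun k hk => hn' k (by omega)⟩
  have hκB : ∀ k : ℕ, B k = κ k := fun k => by rw [← hBκ]; simp [tailFrom]
  obtain ⟨M, hM⟩ := hM
  obtain ⟨n₀, hn₀, h₀⟩ := hinf.exists_gt M
  obtain ⟨n₁, hn₁, h₁⟩ := hinf.exists_gt n₀
  obtain ⟨n₂, hn₂, h₂⟩ := hinf.exists_gt n₁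
  let n : Fin 3 → ℕ := ![n₀, n₁, n₂]
  have hnD : ∀ i, n i ∈ D ∧ M ≤ n i := by
    intro i
    fin_cases i
    exacts [⟨hn₀, h₀.le⟩, ⟨hn₁, (h₀.trans h₁).le⟩, ⟨hn₂, (h₀.trans (h₁.trans h₂)).le⟩]
  have hninj : ∀ i j, i ≠ j → n i ≠ n j := by
    intro i j hij
    fin_cases i <;> fin_cases j <;> simp [n] at hij ⊢ <;> omega
  -- Beyond `M` the follower sets at the three lengths coincide, so the continuation of `κ` after
  -- one prefix is also admissible after the others.
  obtain ⟨i, j, hij, heq⟩ := hT.not_pairwise_ne_of_kneading hκ n (fun i j => by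
    have hj : shiftNat^[n j] κ ∈ followerSet (symbolicDynamics T c) (pastWord A q (n j)) := by
      refine mem_followerSet.2 ⟨_, translate_mem_naturalExtension hB (n j), ?_, ?_⟩
      · rw [← hBκ, shiftNat_iterate_tailFrom]
        ext k; simp [tailFrom]
      · rw [endsAt_pastWord]
        intro t ht
        have h1 := hκB (n j - t)
        have h2 := (hnD j).1 (n j - t) (by omega)
        rw [← h2] at h1
        convert h1 using 2 <;> omega
    rw [hM _ (hnD j).2, ← hM _ (hnD i).2] at hj
    obtain ⟨B', hB', hB'j, hB'w⟩ := mem_followerSet.1 hj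
    rw [endsAt_pastWord] at hB'w
    refine ⟨tailFrom B' (-(n i)), hB' _, fun k hk => ?_, ?_⟩
    · have h1 := hB'w (n i - k) (by omega)
      rw [← (hnD i).1 k hk]
      simp only [tailFrom]
      convert h1 using 2 <;> omega
    · rw [shiftNat_iterate_tailFrom, ← hB'j]; simp)
  -- Two equal shifts make `κ` eventually periodic; reading it along arbitrarily long shadowing
  -- words makes the whole past of `A` periodic.
  have key : ∀ a b : ℕ, a < b → shiftNat^[a] κ = shiftNat^[b] κ →
      ∃ ρ : ℕ, 0 < ρ ∧ ∀ i ≤ q, A (i - ρ) = A i := by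
    intro a b hab heq
    refine ⟨b - a, by omega, fun i hi => ?_⟩
    obtain ⟨n, hn, hlt⟩ := hinf.exists_gt (b + (q - i).toNat)
    have h1 := hn (n - (q - i).toNat) (by omega)
    have h2 := hn (n - (q - i).toNat - (b - a)) (by omega)
    have h3 := congrFun heq (n - (q - i).toNat - b)
    rw [shiftNat_iterate, shiftNat_iterate,
      show n - (q - i).toNat - b + a = n - (q - i).toNat - (b - a) by omega,
      show n - (q - i).toNat - b + b = n - (q - i).toNat by omega, ← h1, ← h2] at h3
    convert h3 using 2 <;> omega
  rcases lt_or_gt_of_ne (hninj i j hij) with hlt | hlt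
  exacts [key _ _ hlt heq, key _ _ hlt heq.symm]

theorem sub_mul_eq_of_past_period {α : Type*} {A : ℤ → α} {q : ℤ} {ρ : ℕ}
    (h : ∀ i ≤ q, A (i - ρ) = A i) (k : ℕ) {i : ℤ} (hi : i ≤ q) : A (i - k * ρ) = A i := by
  induction k with
  | zero => simp
  | succ k ih =>
    rw [← ih, ← h (i - k * ρ) (by
      have : (0 : ℤ) ≤ k * ρ := by positivity
      omega)]
    congr 1; push_cast; ring

/-- A sequence which is always shadowed and Markov at some time is periodic. -/
theorem IsPiecewiseMonotone.mem_periodicPts_of_isShadowedAt (hT : IsPiecewiseMonotone T c)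
    {A : ℤ → Fin N} (hA : A ∈ naturalExtension (symbolicDynamics T c)) {p : ℤ}
    (hM : IsMarkovAt (symbolicDynamics T c) A p)
    (hsh : ∀ q, IsShadowedAt (kneadingSet T c) A q) : A ∈ Function.periodicPts shiftInt := by
  obtain ⟨ρ, hρ, h⟩ := hT.exists_past_period hA hM (hsh p)
  refine ⟨ρ, hρ, isPeriodicPt_shiftInt_iff.2 fun i => ?_⟩
  rcases le_or_gt (i + ρ) p with hi | hi
  · rw [← h (i + ρ) hi]; simp
  · obtain ⟨r, hr, h'⟩ := hT.exists_past_period hA (hM.mono hi.le) (hsh (i + ρ))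
    -- Moving back `k` periods `r` of the longer past brings both indices into the range where `ρ`
    -- is a period.
    set k := (i + ρ - p).toNat with hk
    have hkr : (k : ℤ) ≤ k * r := le_mul_of_one_le_right (by positivity) (by exact_mod_cast hr)
    rw [← sub_mul_eq_of_past_period h' k le_rfl, ← sub_mul_eq_of_past_period h' k (i := i) (by omega),
      ← h (i + ρ - k * r) (by omega)]
    congr 1; ring

end Shadowing

/-! ### Coding bounds for Shannon entropy -/

section Coding

/-- The pointwise Gibbs inequality, from `log x ≤ x - 1`. -/
theorem negMulLog_add_mul_log_le {p q : ℝ} (hp : 0 ≤ p) (hq : 0 < q) :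
    Real.negMulLog p + p * Real.log q ≤ q - p := by
  rcases hp.eq_or_lt with rfl | hp
  · simpa using hq.le
  · have h := Real.log_le_sub_one_of_pos (div_pos hq hp)
    rw [Real.log_div hq.ne' hp.ne'] at h
    have h2 := mul_le_mul_of_nonneg_left h hp.le
    have h3 : p * (q / p - 1) = q - p := by field_simp
    rw [Real.negMulLog]
    linarith

variable {X ι : Type*} [MeasurableSpace X] [Fintype ι]

theorem sum_measureReal_fibre_mul [MeasurableSpace ι] [MeasurableSingletonClass ι] (μ : Measure X)
    [IsProbabilityMeasure μ] {f : X → ι} (hf : Measurable f) (F : ι → ℝ) :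
    ∑ i, μ.real (f ⁻¹' {i}) * F i = ∫ x, F (f x) ∂μ := by
  have := Measure.isProbabilityMeasure_map (μ := μ) hf.aemeasurable
  have hF : Measurable F := measurable_of_finite F
  rw [← integral_map hf.aemeasurable hF.aestronglyMeasurable, integral_fintype (Integrable.of_finite)]
  refine Finset.sum_congr rfl fun i _ => ?_
  rw [map_measureReal_apply hf (measurableSet_singleton i), smul_eq_mul]

/-- A decoder with cheap codes bounds the entropy. -/
theorem shannonEntropy_le_of_decoder [MeasurableSpace ι] [MeasurableSingletonClass ι]
    (μ : Measure X) [IsProbabilityMeasure μ] {f : X → ι} (hf : Measurable f)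
    {α : Type*} [Fintype α] {D : α → ι} (hD : Function.Surjective D) (cost : α → ℕ) {t Z : ℝ}
    (ht : 0 < t) (ht1 : t ≤ 1) (hZ : 0 < Z) (hsum : ∑ a, t ^ cost a ≤ Z) {g : X → ℝ}
    (hg : Integrable g μ) (hcode : ∀ x, ∃ a, D a = f x ∧ (cost a : ℝ) ≤ g x) :
    shannonEntropy μ f ≤ Real.log Z + -Real.log t * ∫ x, g x ∂μ := by
  classical
  have hmin : ∀ v, ∃ a, D a = v ∧ ∀ b, D b = v → cost a ≤ cost b := fun v => by
    obtain ⟨a₀, ha₀⟩ := hD v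
    obtain ⟨a, ha, hle⟩ := Finset.exists_min_image (Finset.univ.filter fun a => D a = v) cost
      ⟨a₀, by simp [ha₀]⟩
    exact ⟨a, by simpa using ha, fun b hb => hle b (by simp [hb])⟩
  choose s hs hsmin using hmin
  have hsinj : Function.Injective s := fun v w h => by rw [← hs v, ← hs w, h]
  -- Kraft-type inequality: cheapest codes, weighted by `t ^ cost / Z`, form a subprobability to
  -- which Gibbs' inequality compares the distribution of `f`.
  have hq : ∑ i, t ^ cost (s i) / Z ≤ 1 := by
    rw [← Finset.sum_div, div_le_one hZ]
    refine le_trans ?_ hsum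
    rw [← Finset.sum_image (f := fun a => t ^ cost a) (s := Finset.univ) (g := s) hsinj.injOn]
    exact Finset.sum_le_sum_of_subset_of_nonneg (Finset.subset_univ _)
      fun _ _ _ => by positivity
  have hp : ∑ i, μ.real (f ⁻¹' {i}) = 1 := by
    have := sum_measureReal_fibre_mul μ hf fun _ => 1
    simpa using this
  have hcost : ∑ i, μ.real (f ⁻¹' {i}) * cost (s i) ≤ ∫ x, g x ∂μ := by
    rw [sum_measureReal_fibre_mul μ hf fun i => (cost (s i) : ℝ)]
    refine integral_mono ?_ hg fun x => ?_
    · exact ((Integrable.of_finite (μ := μ.map f) (f := fun i => (cost (s i) : ℝ)))).comp_measurable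
        hf
    · obtain ⟨a, ha, hle⟩ := hcode x
      exact (Nat.cast_le.2 (hsmin _ a ha)).trans hle
  have hterm : ∀ i, Real.negMulLog (μ.real (f ⁻¹' {i})) ≤ t ^ cost (s i) / Z - μ.real (f ⁻¹' {i}) +
      (μ.real (f ⁻¹' {i}) * Real.log Z + -Real.log t * (μ.real (f ⁻¹' {i}) * cost (s i))) :=
    fun i => by
      have hpos : 0 < t ^ cost (s i) := by positivity
      have := negMulLog_add_mul_log_le (p := μ.real (f ⁻¹' {i})) measureReal_nonneg
        (div_pos hpos hZ)
      rw [Real.log_div hpos.ne' hZ.ne', Real.log_pow] at this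
      linarith
  calc shannonEntropy μ f ≤ ∑ i, (t ^ cost (s i) / Z - μ.real (f ⁻¹' {i}) +
      (μ.real (f ⁻¹' {i}) * Real.log Z +
        -Real.log t * (μ.real (f ⁻¹' {i}) * cost (s i)))) := Finset.sum_le_sum fun i _ => hterm i
    _ = (∑ i, t ^ cost (s i) / Z - 1) + (Real.log Z +
        -Real.log t * ∑ i, μ.real (f ⁻¹' {i}) * cost (s i)) := by
      rw [Finset.sum_add_distrib, Finset.sum_add_distrib, Finset.sum_sub_distrib, ← Finset.sum_mul,
        ← Finset.mul_sum, hp, one_mul]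
    _ ≤ Real.log Z + -Real.log t * ∫ x, g x ∂μ := by
      have := mul_le_mul_of_nonneg_left hcost (neg_nonneg.2 (Real.log_nonpos ht.le ht1))
      linarith

/-- The weight is a product over positions, each contributing `1` for no label and `t` for each
label. -/
theorem sum_pow_card_ne_none {Λ : Type*} [Fintype Λ] [DecidableEq Λ] (L : ℕ) (t : ℝ) :
    ∑ d : Fin L → Option Λ, t ^ (Finset.univ.filter fun j => d j ≠ none).card =
      (1 + Fintype.card Λ * t) ^ L := by
  have h : ∀ d : Fin L → Option Λ, t ^ (Finset.univ.filter fun j => d j ≠ none).card =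
      ∏ j, if d j ≠ none then t else 1 := fun d => by
    rw [Finset.prod_ite]; simp
  simp_rw [h]
  have := Finset.prod_univ_sum (fun _ : Fin L => (Finset.univ : Finset (Option Λ)))
    (fun _ o => if o ≠ none then t else 1)
  rw [Fintype.piFinset_univ] at this
  rw [← this]
  simp [Fintype.sum_option]

end Coding

/-! ### Parsing a sequence into prefixes of given sequences -/

section Parsing

variable {𝒜 Λ : Type*}

/-- The sequence announced at time `n` by the labels `d`: a label `l` restarts the sequence
`φ l`. -/
def announced (φ : Λ → ℕ → 𝒜) (b : ℕ → 𝒜) (d : ℕ → Option Λ) : ℕ → ℕ → 𝒜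
  | 0 => (d 0).elim b φ
  | n + 1 => (d (n + 1)).elim (shiftNat (announced φ b d n)) φ

variable {φ : Λ → ℕ → 𝒜} {b : ℕ → 𝒜}

theorem announced_congr {d d' : ℕ → Option Λ} {n : ℕ} (h : ∀ k ≤ n, d k = d' k) :
    announced φ b d n = announced φ b d' n := by
  induction n with
  | zero => simp [announced, h 0]
  | succ n ih =>
    rw [announced, announced, ih fun k hk => h k (by omega), h _ le_rfl]

theorem announced_add {d : ℕ → Option Λ} {s : ℕ} {l : Λ} (hs : d s = some l) (j : ℕ)
    (h : ∀ i, s < i → i ≤ s + j → d i = none) : announced φ b d (s + j) = shiftNat^[j] (φ l) := by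
  induction j with
  | zero => cases s <;> simp [announced, hs]
  | succ j ih =>
    rw [← add_assoc, announced, h (s + j + 1) (by omega) (by omega),
      ih fun i h1 h2 => h i h1 (by omega), Function.iterate_succ_apply']
    rfl

open Classical in
theorem exists_labels_extend {x : ℕ → 𝒜} {s n : ℕ} {l : Λ} (hl : ∀ j ≤ n, x (s + j) = φ l j)
    {d : ℕ → Option Λ} (hd : ∀ p, s ≤ p → d p = none) (hx : ∀ p < s, announced φ b d p 0 = x p) :
    ∃ d' : ℕ → Option Λ, (∀ p, s + n + 1 ≤ p → d' p = none) ∧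
      (∀ p < s + n + 1, announced φ b d' p 0 = x p) ∧
      ((Finset.range (s + n + 1)).filter fun p => d' p ≠ none).card ≤
        ((Finset.range s).filter fun p => d p ≠ none).card + 1 := by
  refine ⟨Function.update d s (some l), fun p hp => ?_, fun p hp => ?_, ?_⟩
  · rw [Function.update_of_ne (by omega)]; exact hd p (by omega)
  · rcases lt_or_ge p s with hps | hps
    · rw [← hx p hps]
      exact congrFun (announced_congr (n := p) fun k hk =>
        Function.update_of_ne (show k ≠ s by omega) _ _) 0
    · obtain ⟨j, rfl⟩ := Nat.exists_eq_add_of_le hps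
      rw [announced_add (Function.update_self s (some l) d) j fun i h1 h2 => by
        rw [Function.update_of_ne (by omega)]; exact hd i h1.le, shiftNat_iterate, hl j (by omega)]
      simp
  · refine le_trans (Finset.card_le_card (t := insert s ((Finset.range s).filter
      fun p => d p ≠ none)) fun p hp => ?_) (Finset.card_insert_le _ _)
    rw [Finset.mem_filter] at hp
    rw [Finset.mem_insert, Finset.mem_filter, Finset.mem_range]
    by_cases hps : p = s
    · exact Or.inl hps
    · rw [Function.update_of_ne hps] at hp
      refine Or.inr ⟨?_, hp.2⟩
      by_contra! hge
      exact hp.2 (hd p hge)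

open Classical in
/-- A sequence can be parsed with few labels if most positions end a long announced prefix. -/
theorem exists_labels (hφ : ∀ a, ∃ l, φ l 0 = a) {x : ℕ → 𝒜} {Bad : Set ℕ} {m : ℕ}
    (hgood : ∀ p ∉ Bad, ∃ n ≥ m, n ≤ p ∧ ∃ l, ∀ j ≤ n, x (p - n + j) = φ l j) (L : ℕ) :
    ∃ d : ℕ → Option Λ, (∀ p, L ≤ p → d p = none) ∧ (∀ p < L, announced φ b d p 0 = x p) ∧
      (m + 1) * ((Finset.range L).filter fun p => d p ≠ none).card ≤
        L + (m + 1) * ((Finset.range L).filter fun p => p ∈ Bad).card := by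
  induction L using Nat.strong_induction_on with
  | _ L ih =>
  cases L with
  | zero => exact ⟨fun _ => none, by simp⟩
  | succ p =>
    by_cases hp : p ∈ Bad
    · obtain ⟨d, h1, h2, h3⟩ := ih p (by omega)
      obtain ⟨l, hl⟩ := hφ (x p)
      obtain ⟨d', h1', h2', h3'⟩ := exists_labels_extend (x := x) (s := p) (n := 0) (l := l)
        (fun j hj => by obtain rfl : j = 0 := by omega
                        exact hl.symm) h1 h2
      refine ⟨d', h1', h2', ?_⟩
      have : ((Finset.range (p + 1)).filter fun p => p ∈ Bad).card =
          ((Finset.range p).filter fun p => p ∈ Bad).card + 1 := by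
        rw [Finset.range_add_one, Finset.filter_insert, if_pos hp, Finset.card_insert_of_notMem]
        simp
      rw [this]
      calc _ ≤ (m + 1) * (((Finset.range p).filter fun p => d p ≠ none).card + 1) :=
            Nat.mul_le_mul_left _ h3'
        _ ≤ _ := by rw [mul_add, mul_add]; omega
    · obtain ⟨n, hn, hnp, l, hl⟩ := hgood p hp
      obtain ⟨d, h1, h2, h3⟩ := ih (p - n) (by omega)
      obtain ⟨d', h1', h2', h3'⟩ := exists_labels_extend hl h1 h2
      rw [show p - n + n + 1 = p + 1 by omega] at h1' h2' h3'
      refine ⟨d', h1', h2', ?_⟩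
      have : ((Finset.range (p - n)).filter fun p => p ∈ Bad).card ≤
          ((Finset.range (p + 1)).filter fun p => p ∈ Bad).card :=
        Finset.card_le_card (Finset.filter_subset_filter _ (Finset.range_mono (by omega)))
      have := Nat.mul_le_mul_left (m + 1) this
      calc _ ≤ (m + 1) * (((Finset.range (p - n)).filter fun p => d p ≠ none).card + 1) :=
            Nat.mul_le_mul_left _ h3'
        _ ≤ _ := by rw [mul_add]; omega

end Parsing

/-! ### Approximation of partitions by finitely many coordinates -/

section Approximation

variable {𝒜 : Type*} [MeasurableSpace 𝒜]

/-- Each fibre of `Q` is approximated by a cylinder set. Off the symmetric differences, a point lies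
in exactly one of these sets, the one indexed by `Q x`. -/
theorem exists_window_approximation (μ : Measure (ℤ → 𝒜)) [IsProbabilityMeasure μ] {k : ℕ}
    {Q : (ℤ → 𝒜) → Fin k} (hQ : Measurable Q) {δ : ℝ} (hδ : 0 < δ) :
    ∃ (r : ℕ) (Q' : (ℤ → 𝒜) → Fin k) (Δ : Set (ℤ → 𝒜)), MeasurableSet Δ ∧ μ.real Δ ≤ δ ∧
      (∀ x ∉ Δ, Q x = Q' x) ∧ ∀ x y, (∀ i : ℤ, |i| ≤ r → x i = y i) → Q' x = Q' y := by
  classical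
  have hdense : μ.MeasureDense (measurableCylinders fun _ : ℤ => 𝒜) :=
    Measure.MeasureDense.of_generateFrom_isSetAlgebra_finite μ isSetAlgebra_measurableCylinders
      generateFrom_measurableCylinders.symm
  have hδ' : 0 < δ / (k + 1) := by positivity
  have happ : ∀ i : Fin k, ∃ C ∈ measurableCylinders fun _ : ℤ => 𝒜,
      μ (symmDiff (Q ⁻¹' {i}) C) < ENNReal.ofReal (δ / (k + 1)) := fun i =>
    hdense.approx _ (hQ (measurableSet_singleton i)) (measure_ne_top _ _) _ hδ'
  choose C hC hμC using happ
  have hCm : ∀ i, MeasurableSet (C i) := fun i => hdense.measurable _ (hC i)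
  simp only [mem_measurableCylinders] at hC
  choose s U _ hCU using hC
  obtain ⟨x₀⟩ : Nonempty (ℤ → 𝒜) := nonempty_of_isProbabilityMeasure μ
  let F : Set (Fin k) → Fin k := fun s => if h : s.Nonempty then h.some else Q x₀
  refine ⟨Finset.univ.sup fun i => (s i).sup Int.natAbs, fun x => F {i | x ∈ C i},
    ⋃ i, symmDiff (Q ⁻¹' {i}) (C i), ?_, ?_, ?_, ?_⟩
  · exact MeasurableSet.iUnion fun i => (hQ (measurableSet_singleton i)).symmDiff (hCm i)
  · calc _ ≤ ∑ i : Fin k, μ.real (symmDiff (Q ⁻¹' {i}) (C i)) := measureReal_iUnion_fintype_le _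
      _ ≤ ∑ _i : Fin k, δ / (k + 1) := Finset.sum_le_sum fun i _ =>
          ENNReal.toReal_le_of_le_ofReal hδ'.le (hμC i).le
      _ ≤ δ := by
        rw [Finset.sum_const, Finset.card_univ, Fintype.card_fin, nsmul_eq_mul, mul_div_assoc',
          div_le_iff₀ (by positivity)]
        nlinarith
  · intro x hx
    simp only [mem_iUnion, not_exists, mem_symmDiff, not_or, not_and, not_not, mem_preimage,
      mem_singleton_iff] at hx
    have : {i | x ∈ C i} = {Q x} := by
      ext i
      exact ⟨fun hi => ((hx i).2 hi).symm, fun hi => (hx i).1 hi.symm⟩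
    change Q x = F {i | x ∈ C i}
    rw [this]
    have hne : ({Q x} : Set (Fin k)).Nonempty := singleton_nonempty _
    simp only [F, dif_pos hne]
    exact hne.some_mem.symm
  · intro x y hxy
    have : {i | x ∈ C i} = {i | y ∈ C i} := by
      ext i
      simp only [mem_ofPred_eq, hCU, mem_cylinder]
      have : (s i).restrict x = (s i).restrict y := by
        ext ⟨j, hj⟩
        refine hxy j ?_
        have h1 : j.natAbs ≤ (s i).sup Int.natAbs := Finset.le_sup hj
        have h2 : (s i).sup Int.natAbs ≤ Finset.univ.sup fun i => (s i).sup Int.natAbs :=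
          Finset.le_sup (f := fun i => (s i).sup Int.natAbs) (Finset.mem_univ i)
        have := h1.trans h2
        rw [Int.abs_eq_natAbs]
        exact_mod_cast this
      rw [this]
    simp only [this]

theorem measurable_partitionName {X : Type*} [MeasurableSpace X] {T : X → X} (hT : Measurable T)
    {k : ℕ} {P : X → Fin k} (hP : Measurable P) (n : ℕ) : Measurable (partitionName T P n) :=
  measurable_pi_lambda _ fun j => hP.comp (hT.iterate j)

end Approximation

/-- The constant `b` may depend on `η`: it disappears after division by `n`. -/
theorem partitionEntropy_eq_zero_of_le {X : Type*} [MeasurableSpace X] {T : X → X} {μ : Measure X}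
    {k : ℕ} {P : X → Fin k} (h : ∀ η > 0, ∃ b : ℝ, ∀ n : ℕ,
      shannonEntropy μ (partitionName T P n) ≤ η * n + b) : partitionEntropy T μ P = 0 := by
  rw [← nonpos_iff_eq_zero]
  refine ENNReal.le_of_forall_pos_le_add fun ε hε _ => ?_
  obtain ⟨b, hb⟩ := h (ε / 2) (by positivity)
  rw [zero_add]
  refine limsup_le_of_le (h := ?_)
  have hlim : Tendsto (fun n : ℕ => b / (n : ℝ)) atTop (𝓝 0) := tendsto_const_div_atTop_nhds_zero_nat b
  have hε2 : (0 : ℝ) < ε / 2 := by positivity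
  filter_upwards [hlim.eventually_lt_const hε2, eventually_gt_atTop 0] with n hn hn0
  rw [← ENNReal.ofReal_coe_nnreal]
  refine ENNReal.ofReal_le_ofReal ?_
  have hn0' : (0 : ℝ) < n := by exact_mod_cast hn0
  calc _ ≤ ((ε : ℝ) / 2 * n + b) / n := by gcongr; exact hb n
    _ = ε / 2 + b / n := by field_simp
    _ ≤ ε := by linarith

/-! ### Zero entropy of shadowed measures -/

section ZeroEntropy

variable {𝒜 : Type*} {K : Set (ℕ → 𝒜)}

/-- The sequences for which no word `A_{q-n} … A_q` with `m ≤ n ≤ M` is the beginning of an element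
of `K`. -/
def unshadowed (K : Set (ℕ → 𝒜)) (m M : ℕ) (q : ℤ) : Set (ℤ → 𝒜) :=
  {A | ∀ n : ℕ, m ≤ n → n ≤ M → ∀ κ ∈ K, ∃ j : ℕ, j ≤ n ∧ A (q - n + j) ≠ κ j}

theorem shiftInt_preimage_unshadowed (m M : ℕ) (q : ℤ) :
    shiftInt ⁻¹' unshadowed K m M q = unshadowed K m M (q + 1) := by
  ext A
  simp only [unshadowed, mem_preimage, mem_ofPred_eq, shiftInt]
  have : ∀ n j : ℕ, q - n + j + 1 = q + 1 - n + j := fun n j => by ring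
  simp only [this]

variable [MeasurableSpace 𝒜] [DiscreteMeasurableSpace 𝒜]

theorem measurableSet_unshadowed [Countable 𝒜] (m M : ℕ) (q : ℤ) :
    MeasurableSet (unshadowed K m M q) := by
  refine measurableSet_of_finite_coordinates (Finset.Icc (q - M) q) fun x y hxy hx n h1 h2 κ hκ => ?_
  obtain ⟨j, hj, hne⟩ := hx n h1 h2 κ hκ
  exact ⟨j, hj, by rwa [← hxy _ (by rw [Finset.mem_Icc]; omega)]⟩

theorem measureReal_unshadowed [Countable 𝒜] {μ : Measure (ℤ → 𝒜)}
    (hμ : MeasurePreserving shiftInt μ μ) (m M : ℕ) (q : ℤ) :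
    μ.real (unshadowed K m M q) = μ.real (unshadowed K m M 0) := by
  have hstep : ∀ q, μ.real (unshadowed K m M (q + 1)) = μ.real (unshadowed K m M q) := fun q => by
    rw [← shiftInt_preimage_unshadowed, measureReal_def, measureReal_def,
      hμ.measure_preimage (measurableSet_unshadowed m M q).nullMeasurableSet]
  induction q using Int.induction_on with
  | zero => rfl
  | succ q ih => rw [hstep, ih]
  | pred q ih => rw [← ih, ← hstep (-(q : ℤ) - 1), sub_add_cancel]

/-- These sets decrease with `M`, and a point of their intersection is not shadowed at time `0`. -/
theorem exists_measureReal_unshadowed_le [Countable 𝒜] {μ : Measure (ℤ → 𝒜)}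
    [IsProbabilityMeasure μ] (h : ∀ᵐ A ∂μ, IsShadowedAt K A 0) (m : ℕ) {ε : ℝ} (hε : 0 < ε) :
    ∃ M, μ.real (unshadowed K m M 0) ≤ ε := by
  have hanti : Antitone fun M => unshadowed K m M 0 := fun M M' hM A hA n h1 h2 =>
    hA n h1 (h2.trans hM)
  have hlim := tendsto_measure_iInter_atTop (μ := μ)
    (fun M => (measurableSet_unshadowed (K := K) m M 0).nullMeasurableSet) hanti
    ⟨0, measure_ne_top _ _⟩
  have hzero : μ (⋂ M, unshadowed K m M 0) = 0 := by
    refine measure_mono_null (t := {A | ¬ IsShadowedAt K A 0}) (fun A hA hsh => ?_) (ae_iff.1 h)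
    obtain ⟨n, hn, κ, hκ, hj⟩ := hsh m
    obtain ⟨j, hjn, hne⟩ := mem_iInter.1 hA n n hn le_rfl κ hκ
    exact hne (hj j hjn)
  rw [hzero] at hlim
  obtain ⟨M, hM⟩ := (hlim.eventually_lt_const (ENNReal.ofReal_pos.2 hε)).exists
  exact ⟨M, ENNReal.toReal_le_of_le_ofReal hε.le hM.le⟩

theorem card_filter_fin_eq (L : ℕ) (P : ℕ → Prop) [DecidablePred P] :
    ((Finset.univ : Finset (Fin L)).filter fun j : Fin L => P j).card =
      ((Finset.range L).filter P).card := by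
  rw [Finset.card_filter, Finset.card_filter, Fin.sum_univ_eq_sum_range fun j => if P j then 1 else 0]

open Classical in
-- A name is encoded by labels spelling the coordinates from `-r` to `L + r - 1`, which determine
-- the name for `Q'`, together with corrections at the visits to `Δ`. The cost counts labels and
-- corrections; its mean is bounded by invariance.
theorem shannonEntropy_partitionName_le [Fintype 𝒜] [Fintype K] {μ : Measure (ℤ → 𝒜)}
    [IsProbabilityMeasure μ] (hμ : MeasurePreserving shiftInt μ μ) {k : ℕ}
    {Q Q' : (ℤ → 𝒜) → Fin k} (hQ : Measurable Q) {Δ : Set (ℤ → 𝒜)} (hΔ : MeasurableSet Δ)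
    (hQΔ : ∀ x ∉ Δ, Q x = Q' x) {r : ℕ}
    (hQ' : ∀ x y, (∀ i : ℤ, |i| ≤ r → x i = y i) → Q' x = Q' y) (m M : ℕ) {t : ℝ} (ht : 0 < t)
    (ht1 : t ≤ 1) (L : ℕ) :
    shannonEntropy μ (partitionName shiftInt Q L) ≤
      Real.log ((1 + Fintype.card (K ⊕ 𝒜) * t) ^ (L + 2 * r) * (1 + k * t) ^ L) +
      -Real.log t * ((L + 2 * r : ℕ) / (m + 1) + M +
        (L + 2 * r : ℕ) * μ.real (unshadowed K m M 0) + L * μ.real Δ) := by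
  set L' := L + 2 * r with hL'
  obtain ⟨A₀⟩ : Nonempty (ℤ → 𝒜) := nonempty_of_isProbabilityMeasure μ
  -- The letters serve as labels for isolated bad positions; only the first symbol of the constant
  -- sequence matters there.
  let φ : K ⊕ 𝒜 → ℕ → 𝒜 := Sum.elim Subtype.val fun a _ => a
  let ext : (Fin L' → Option (K ⊕ 𝒜)) → ℕ → Option (K ⊕ 𝒜) :=
    fun d p => if h : p < L' then d ⟨p, h⟩ else none
  let y : (Fin L' → Option (K ⊕ 𝒜)) → ℤ → 𝒜 :=
    fun d i => announced φ (tailFrom A₀ 0) (ext d) (i + r).toNat 0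
  let D : (Fin L' → Option (K ⊕ 𝒜)) × (Fin L → Option (Fin k)) → Fin L → Fin k :=
    fun a j => (a.2 j).elim (Q' (shiftInt^[j] (y a.1))) id
  let cost : (Fin L' → Option (K ⊕ 𝒜)) × (Fin L → Option (Fin k)) → ℕ := fun a =>
    (Finset.univ.filter fun j => a.1 j ≠ none).card +
      (Finset.univ.filter fun j => a.2 j ≠ none).card
  have hD : Function.Surjective D := fun v => ⟨(fun _ => none, fun j => some (v j)), rfl⟩
  have hsum : ∑ a, t ^ cost a ≤
      (1 + Fintype.card (K ⊕ 𝒜) * t) ^ L' * (1 + k * t) ^ L := by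
    have h2 := sum_pow_card_ne_none (Λ := Fin k) L t
    rw [Fintype.card_fin] at h2
    rw [← h2, ← sum_pow_card_ne_none L' t, Finset.sum_mul_sum, Fintype.sum_prod_type]
    simp only [cost, pow_add]
    exact le_rfl
  let f₁ : ℕ → (ℤ → 𝒜) → ℝ := fun p => (unshadowed K m M ((p : ℤ) - r)).indicator 1
  let f₂ : ℕ → (ℤ → 𝒜) → ℝ := fun j => (shiftInt^[j] ⁻¹' Δ).indicator 1
  let g : (ℤ → 𝒜) → ℝ := fun A => ((L' : ℝ) / (m + 1) + M) +
    (∑ p ∈ Finset.range L', f₁ p A + ∑ j ∈ Finset.range L, f₂ j A)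
  have hm₂ : ∀ j : ℕ, MeasurableSet (shiftInt^[j] ⁻¹' Δ) := fun j =>
    (hμ.iterate j).measurable hΔ
  have hi₁ : ∀ p, Integrable (f₁ p) μ := fun p =>
    (integrable_const 1).indicator (measurableSet_unshadowed _ _ _)
  have hi₂ : ∀ j, Integrable (f₂ j) μ := fun j => (integrable_const 1).indicator (hm₂ j)
  have hs₁ : Integrable (fun A => ∑ p ∈ Finset.range L', f₁ p A) μ :=
    integrable_finsetSum _ fun p _ => hi₁ p
  have hs₂ : Integrable (fun A => ∑ j ∈ Finset.range L, f₂ j A) μ :=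
    integrable_finsetSum _ fun j _ => hi₂ j
  have hg : Integrable g μ := (integrable_const _).add (hs₁.add hs₂)
  have hint : ∫ A, g A ∂μ = (L' : ℝ) / (m + 1) + M +
      L' * μ.real (unshadowed K m M 0) + L * μ.real Δ := by
    have e₁ : ∀ p, ∫ A, f₁ p A ∂μ = μ.real (unshadowed K m M 0) := fun p => by
      rw [integral_indicator_one (measurableSet_unshadowed _ _ _), measureReal_unshadowed hμ]
    have e₂ : ∀ j, ∫ A, f₂ j A ∂μ = μ.real Δ := fun j => by
      rw [integral_indicator_one (hm₂ j), measureReal_def,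
        (hμ.iterate j).measure_preimage hΔ.nullMeasurableSet]; rfl
    have h₁ := integral_add (integrable_const ((L' : ℝ) / (m + 1) + M)) (hs₁.add hs₂)
    have h₂ := integral_add hs₁ hs₂
    rw [integral_finsetSum _ fun p _ => hi₁ p, integral_finsetSum _ fun j _ => hi₂ j] at h₂
    refine (h₁.trans (congrArg _ h₂)).trans ?_
    simp only [e₁, e₂, integral_const, probReal_univ, Finset.sum_const, Finset.card_range,
      smul_eq_mul, nsmul_eq_mul, one_mul]
    ring
  have hcode : ∀ A, ∃ a, D a = partitionName shiftInt Q L A ∧ (cost a : ℝ) ≤ g A := by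
    intro A
    -- The first `M` positions are discarded because a shadowing word ending there may start before
    -- the window.
    let Bad : Set ℕ := {p | p < M ∨ A ∈ unshadowed K m M ((p : ℤ) - r)}
    obtain ⟨d, hd, hdx, hcard⟩ := exists_labels (φ := φ) (b := tailFrom A₀ 0) (m := m)
      (x := fun p => A ((p : ℤ) - r)) (Bad := Bad) (fun a => ⟨Sum.inr a, rfl⟩) (fun p hp => by
        simp only [Bad, mem_ofPred_eq, not_or, unshadowed] at hp
        push Not at hp
        obtain ⟨hpM, n, h1, h2, κ, hκ, hj⟩ := hp
        refine ⟨n, h1, by omega, Sum.inl ⟨κ, hκ⟩, fun j hjn => ?_⟩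
        rw [← show κ j = φ (Sum.inl ⟨κ, hκ⟩) j from rfl, ← hj j hjn]
        congr 1
        push_cast [h2.trans hpM]
        ring) L'
    let d' : Fin L' → Option (K ⊕ 𝒜) := fun p => d p
    have hext : ext d' = d := by
      funext p
      by_cases hp : p < L'
      · simp [ext, d', hp]
      · simp [ext, hp, hd p (not_lt.1 hp)]
    have hy : ∀ i : ℤ, -r ≤ i → i < L + r → y d' i = A i := fun i h1 h2 => by
      simp only [y, hext]
      rw [hdx _ (by omega)]
      congr 1
      omega
    let e : Fin L → Option (Fin k) := fun j =>
      if shiftInt^[(j : ℕ)] A ∈ Δ then some (Q (shiftInt^[(j : ℕ)] A)) else none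
    refine ⟨(d', e), ?_, ?_⟩
    · funext j
      by_cases hj : shiftInt^[(j : ℕ)] A ∈ Δ
      · simp [D, e, hj, partitionName]
      · simp only [D, e, hj, if_false, Option.elim_none, partitionName]
        rw [hQΔ _ hj]
        refine hQ' _ _ fun i hi => ?_
        rw [shiftInt_iterate, shiftInt_iterate]
        have := abs_le.1 hi
        have := j.2
        exact hy _ (by omega) (by omega)
    · have hc₁ : ((Finset.univ.filter fun j => d' j ≠ none).card : ℝ) ≤
          (L' : ℝ) / (m + 1) + M + ∑ p ∈ Finset.range L', f₁ p A := by
        have hbad : ((Finset.range L').filter fun p => p ∈ Bad).card ≤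
            M + ((Finset.range L').filter fun p : ℕ => A ∈ unshadowed K m M ((p : ℤ) - r)).card := by
          refine (Finset.card_le_card (t := Finset.range M ∪ (Finset.range L').filter
            fun p : ℕ => A ∈ unshadowed K m M ((p : ℤ) - r)) fun p hp => ?_).trans
            ((Finset.card_union_le _ _).trans (by rw [Finset.card_range]))
          rw [Finset.mem_filter] at hp
          rw [Finset.mem_union, Finset.mem_range, Finset.mem_filter]
          exact hp.2.imp id fun h => ⟨hp.1, h⟩
        have hf₁ : ∑ p ∈ Finset.range L', f₁ p A = ((Finset.range L').filter
            fun p : ℕ => A ∈ unshadowed K m M ((p : ℤ) - r)).card := by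
          simp only [f₁, indicator_apply, Pi.one_apply]
          rw [Finset.sum_boole]
        rw [hf₁, card_filter_fin_eq L' fun p => d p ≠ none]
        have hm : (0 : ℝ) < m + 1 := by positivity
        rw [add_assoc, ← sub_le_iff_le_add, le_div_iff₀ hm]
        have h1 : ((m + 1) * ((Finset.range L').filter fun p => d p ≠ none).card : ℝ) ≤
            L' + (m + 1) * ((Finset.range L').filter fun p => p ∈ Bad).card := by
          rw [← Nat.cast_add_one, ← Nat.cast_mul, ← Nat.cast_mul, ← Nat.cast_add, Nat.cast_le]
          convert hcard
        have h2 : (((Finset.range L').filter fun p => p ∈ Bad).card : ℝ) ≤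
            M + ((Finset.range L').filter
              fun p : ℕ => A ∈ unshadowed K m M ((p : ℤ) - r)).card := by
          exact_mod_cast hbad
        have h3 := mul_le_mul_of_nonneg_left h2 hm.le
        linarith
      have hc₂ : ((Finset.univ.filter fun j => e j ≠ none).card : ℝ) =
          ∑ j ∈ Finset.range L, f₂ j A := by
        simp only [f₂, indicator_apply, Pi.one_apply, mem_preimage]
        rw [Finset.sum_boole, ← card_filter_fin_eq L fun j => shiftInt^[j] A ∈ Δ]
        simp [e]
      simp only [cost, g]
      push_cast
      linarith
  have hmeas : Measurable (partitionName shiftInt Q L) :=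
    measurable_partitionName hμ.measurable hQ L
  have := shannonEntropy_le_of_decoder μ hmeas hD cost ht ht1 (by positivity) hsum hg hcode
  rwa [hint] at this

/-- An invariant measure almost every element of which is shadowed by a finite set has zero
entropy. -/
theorem measuredEntropy_eq_zero_of_ae_isShadowedAt [Finite 𝒜] (hK : K.Finite)
    {μ : Measure (ℤ → 𝒜)} [IsProbabilityMeasure μ] (hμ : MeasurePreserving shiftInt μ μ)
    (h : ∀ᵐ A ∂μ, IsShadowedAt K A 0) : measuredEntropy shiftInt μ = 0 := by
  have := Fintype.ofFinite 𝒜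
  have := hK.fintype
  rw [measuredEntropy]
  simp only [ENNReal.iSup_eq_zero]
  intro k Q hQ
  refine partitionEntropy_eq_zero_of_le fun η hη => ?_
  set C : ℝ := (Fintype.card (K ⊕ 𝒜) : ℝ)
  have hC0 : 0 ≤ C := Nat.cast_nonneg _
  -- The target `η` is split in four: `t` bounds the logarithms by `η / 4` per unit of time. Only
  -- then is `ε` chosen, so that each of the three frequencies (labels, unshadowed positions,
  -- corrections), multiplied by `-log t`, costs at most `η / 4`.
  set t : ℝ := min 1 (η / (4 * (C + k + 1))) with ht
  have hden : 0 < 4 * (C + k + 1) := by positivity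
  have ht0 : 0 < t := lt_min one_pos (by positivity)
  have ht1 : t ≤ 1 := min_le_left _ _
  have htη : (C + k) * t ≤ η / 4 := by
    have : t * (4 * (C + k + 1)) ≤ η := (le_div_iff₀ hden).1 (min_le_right _ _)
    nlinarith
  set s : ℝ := -Real.log t with hs
  have hs0 : 0 ≤ s := neg_nonneg.2 (Real.log_nonpos ht0.le ht1)
  have hs1 : 0 < s + 1 := by positivity
  set ε : ℝ := η / 4 / (s + 1) with hε
  have hε0 : 0 < ε := by positivity
  have hsε : ∀ u ≤ ε, s * u ≤ η / 4 := fun u hu => by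
    have h1 : (s + 1) * ε = η / 4 := by rw [hε]; field_simp
    nlinarith [mul_le_mul_of_nonneg_left hu hs0]
  obtain ⟨m, hm⟩ := exists_nat_one_div_lt hε0
  obtain ⟨M, hM⟩ := exists_measureReal_unshadowed_le h m hε0
  obtain ⟨r, Q', Δ, hΔ, hμΔ, hQΔ, hQ'⟩ := exists_window_approximation μ hQ hε0
  refine ⟨2 * r * (C * t + s * (1 / (m + 1)) + s * μ.real (unshadowed K m M 0)) + s * M,
    fun L => ?_⟩
  refine (shannonEntropy_partitionName_le (K := K) hμ hQ hΔ hQΔ hQ' m M ht0 ht1 L).trans ?_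
  have hlog : ∀ u : ℝ, 0 ≤ u → Real.log (1 + u) ≤ u := fun u hu => by
    have := Real.log_le_sub_one_of_pos (x := 1 + u) (by linarith)
    linarith
  have hCt : 0 ≤ C * t := by positivity
  have hkt : 0 ≤ k * t := by positivity
  rw [Real.log_mul (by positivity) (by positivity), Real.log_pow, Real.log_pow]
  have h1 := mul_le_mul_of_nonneg_left (hlog _ hCt) (Nat.cast_nonneg (α := ℝ) (L + 2 * r))
  have h2 := mul_le_mul_of_nonneg_left (hlog _ hkt) (Nat.cast_nonneg (α := ℝ) L)
  have hL : (0 : ℝ) ≤ L := Nat.cast_nonneg _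
  have h3 := mul_le_mul_of_nonneg_left htη hL
  have h4 := mul_le_mul_of_nonneg_left (hsε _ hm.le) hL
  have h5 := mul_le_mul_of_nonneg_left (hsε _ hM) hL
  have h6 := mul_le_mul_of_nonneg_left (hsε _ hμΔ) hL
  push_cast at h1 ⊢
  rw [div_eq_mul_one_div ((L : ℝ) + 2 * r)]
  linarith

end ZeroEntropy

theorem measure_isMarkovAt_eq {𝒜 : Type*} [MeasurableSpace 𝒜] [DiscreteMeasurableSpace 𝒜]
    [Countable 𝒜] {S : Set (ℕ → 𝒜)} {μ : Measure (ℤ → 𝒜)} (hμ : MeasurePreserving shiftInt μ μ)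
    (n : ℕ) : μ {A | IsMarkovAt S A (-n)} = μ {A | IsMarkovAt S A 0} := by
  induction n with
  | zero => simp
  | succ n ih =>
    rw [← ih, ← hμ.measure_preimage (measurableSet_isMarkovAt S _).nullMeasurableSet]
    congr 1
    ext A
    simp only [mem_preimage, mem_ofPred_eq, isMarkovAt_shiftInt]
    rw [show (-((n + 1 : ℕ) : ℤ) + 1) = -n by push_cast; ring]

/-- Being Markov at time `-n` is more restrictive as `n` grows, yet has constant measure by
invariance. Hence being Markov at time `0` has the measure of being Markov at all times. -/
theorem measure_isMarkovAt_eq_zero {𝒜 : Type*} [MeasurableSpace 𝒜] [DiscreteMeasurableSpace 𝒜]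
    [Countable 𝒜] {S : Set (ℕ → 𝒜)} {μ : Measure (ℤ → 𝒜)} [IsFiniteMeasure μ]
    (hμ : MeasurePreserving shiftInt μ μ) (h : μ (naturalExtension S \ markovPart S)ᶜ = 0) :
    μ {A | IsMarkovAt S A 0} = 0 := by
  have hlim := tendsto_measure_iInter_atTop (μ := μ) (s := fun n : ℕ => {A | IsMarkovAt S A (-n)})
    (fun n => (measurableSet_isMarkovAt S _).nullMeasurableSet)
    (fun m n hmn A (hA : IsMarkovAt S A (-n)) => hA.mono (by omega)) ⟨0, measure_ne_top _ _⟩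
  have hconst : (μ ∘ fun n : ℕ => {A | IsMarkovAt S A (-n)}) =
      fun _ => μ {A | IsMarkovAt S A 0} := funext fun n => measure_isMarkovAt_eq hμ n
  rw [hconst] at hlim
  rw [tendsto_nhds_unique tendsto_const_nhds hlim]
  refine measure_mono_null (fun A hA => ?_) h
  rintro ⟨hAS, hAM⟩
  refine hAM ⟨hAS, fun p => IsMarkovAt.mono (mem_iInter.1 hA p.natAbs) ?_⟩
  omega

/-! ### Conclusions for piecewise monotone maps -/

section PiecewiseMonotone

variable {N : ℕ} {T : ℝ → ℝ} {c : Fin (N + 1) → ℝ}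

theorem IsPiecewiseMonotone.carriesOnlyZeroEntropy (hT : IsPiecewiseMonotone T c) :
    CarriesOnlyZeroEntropy shiftInt
      (naturalExtension (symbolicDynamics T c) \ markovPart (symbolicDynamics T c)) := by
  intro μ _ hμ h
  refine measuredEntropy_eq_zero_of_ae_isShadowedAt hT.finite_kneadingSet hμ ?_
  have h1 : ∀ᵐ A ∂μ, A ∈ naturalExtension (symbolicDynamics T c) \
      markovPart (symbolicDynamics T c) := h
  have h2 : ∀ᵐ A ∂μ, ¬ IsMarkovAt (symbolicDynamics T c) A 0 := by
    rw [ae_iff]; simpa using measure_isMarkovAt_eq_zero hμ h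
  filter_upwards [h1, h2] with A hA hA'
  exact hT.isShadowedAt_of_not_isMarkovAt hA.1 hA'

theorem IsPiecewiseMonotone.isShadowedAt_iff (hT : IsPiecewiseMonotone T c) {A : ℤ → Fin N}
    (hA : A ∈ naturalExtension (symbolicDynamics T c) \
      periodicWithTailIn (symbolicDynamics T c) (kneadingSet T c)) :
    (∀ p : ℤ, IsShadowedAt (kneadingSet T c) A p) ↔
      ∀ p : ℤ, ¬ IsMarkovAt (symbolicDynamics T c) A p := by
  refine ⟨fun h p hM => hA.2 ?_, fun h p => hT.isShadowedAt_of_not_isMarkovAt hA.1 (h p)⟩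
  have hper := hT.mem_periodicPts_of_isShadowedAt hA.1 hM h
  exact ⟨hA.1, hper, (h p).exists_tailFrom_mem hT.finite_kneadingSet hper⟩

/-- The periodic sequences which are not Markov. -/
def periodicNonMarkov (S : Set (ℕ → Fin N)) : Set (ℤ → Fin N) :=
  (naturalExtension S \ markovPart S) ∩ Function.periodicPts shiftInt

theorem IsPiecewiseMonotone.finite_periodicNonMarkov (hT : IsPiecewiseMonotone T c) :
    (periodicNonMarkov (symbolicDynamics T c)).Finite := by
  refine (finite_periodicWithTailIn (S := symbolicDynamics T c) hT.finite_kneadingSet).subset ?_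
  rintro A ⟨⟨hA, hM⟩, hper⟩
  obtain ⟨p, hp⟩ : ∃ p, ¬ IsMarkovAt (symbolicDynamics T c) A p := by
    by_contra! hcon
    exact hM ⟨hA, hcon⟩
  exact ⟨hA, hper,
    (hT.isShadowedAt_of_not_isMarkovAt hA hp).exists_tailFrom_mem hT.finite_kneadingSet hper⟩

theorem shiftInt_mem_periodicNonMarkov {S : Set (ℕ → Fin N)} {A : ℤ → Fin N}
    (hA : A ∈ periodicNonMarkov S) : shiftInt A ∈ periodicNonMarkov S := by
  obtain ⟨⟨h1, h2⟩, n, hn, h3⟩ := hA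
  refine ⟨⟨shiftInt_mem_naturalExtension_iff.2 h1, fun h => h2 ?_⟩, n, hn, h3.apply⟩
  rwa [← shiftInt_preimage_markovPart S]

/-- A periodic one-sided sequence has a unique periodic two-sided extension; if this is Markov, it
lifts to a path, which is periodic because the projection is injective on paths and commutes with
the shifts. -/
theorem IsPiecewiseMonotone.bijOn_periodicPts (hT : IsPiecewiseMonotone T c) :
    BijOn (fun α => tailFrom (hofbauerProj (symbolicDynamics T c) α) 0)
      (hofbauerShift (symbolicDynamics T c) ∩ Function.periodicPts shiftInt)
      ((symbolicDynamics T c ∩ Function.periodicPts shiftNat) \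
        (fun A => tailFrom A 0) '' periodicNonMarkov (symbolicDynamics T c)) := by
  set S := symbolicDynamics T c
  have hbij := hofbauerProj_bijOn (isClosed_symbolicDynamics T c)
  have hsemi : Function.Semiconj (hofbauerProj S) shiftInt shiftInt := fun _ => rfl
  have hproj : ∀ α ∈ Function.periodicPts (shiftInt : (ℤ → MarkovDiagram S) → _),
      hofbauerProj S α ∈ Function.periodicPts shiftInt := fun α ⟨n, hn, h⟩ => ⟨n, hn, h.map hsemi⟩
  refine ⟨?_, ?_, ?_⟩
  · rintro α ⟨hα, hper⟩
    have hA := hbij.mapsTo hα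
    refine ⟨⟨hA.1 0, tailFrom_mem_periodicPts (hproj α hper) 0⟩, ?_⟩
    rintro ⟨B, hB, hBA⟩
    have := tailFrom_injOn_periodicPts hB.2 (hproj α hper) hBA
    exact hB.1.2 (this ▸ hA)
  · rintro α ⟨hα, hαp⟩ β ⟨hβ, hβp⟩ h
    exact hbij.injOn hα hβ (tailFrom_injOn_periodicPts (hproj α hαp) (hproj β hβp) h)
  · rintro b ⟨⟨hb, hper⟩, hbE⟩
    obtain ⟨A, hA, hAp, rfl⟩ := exists_periodic_extension
      (fun B hB => hT.shiftNat_mem_symbolicDynamics hB) hb hper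
    have hAM : A ∈ markovPart S := by
      by_contra hcon
      exact hbE ⟨A, ⟨⟨hA, hcon⟩, hAp⟩, rfl⟩
    obtain ⟨α, hα, rfl⟩ := hbij.surjOn hAM
    obtain ⟨n, hn, h⟩ := hAp
    refine ⟨α, ⟨hα, n, hn, hbij.injOn ?_ hα ?_⟩, rfl⟩
    · have : MapsTo shiftInt (hofbauerShift S) (hofbauerShift S) := fun β hβ => by
        rwa [← shiftInt_preimage_hofbauerShift S] at hβ
      exact this.iterate n hα
    · rw [hsemi.iterate_right n]; exact h

theorem IsPiecewiseMonotone.minimalPeriod_tailFrom_hofbauerProj (hT : IsPiecewiseMonotone T c)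
    {α : ℤ → MarkovDiagram (symbolicDynamics T c)}
    (hα : α ∈ hofbauerShift (symbolicDynamics T c) ∩ Function.periodicPts shiftInt) :
    Function.minimalPeriod shiftNat (tailFrom (hofbauerProj (symbolicDynamics T c) α) 0) =
      Function.minimalPeriod shiftInt α := by
  have hsemi : Function.Semiconj (fun α => tailFrom (hofbauerProj (symbolicDynamics T c) α) 0)
      shiftInt shiftNat := fun β => by
    rw [shiftNat_tailFrom, ← tailFrom_shiftInt]; rfl
  refine Function.minimalPeriod_eq_minimalPeriod_iff.2 fun n => ⟨fun h => ?_, fun h => h.map hsemi⟩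
  have hmaps : MapsTo shiftInt
      (hofbauerShift (symbolicDynamics T c) ∩ Function.periodicPts shiftInt)
      (hofbauerShift (symbolicDynamics T c) ∩ Function.periodicPts shiftInt) := by
    rintro β ⟨hβ, m, hm, hβm⟩
    refine ⟨?_, m, hm, hβm.apply⟩
    rwa [← shiftInt_preimage_hofbauerShift] at hβ
  refine hT.bijOn_periodicPts.injOn (hmaps.iterate n hα) hα ?_
  exact (hsemi.iterate_right n α).trans h

end PiecewiseMonotone

theorem mainTheorem2 {N : ℕ} (T : ℝ → ℝ) (c : Fin (N + 1) → ℝ) (hT : IsPiecewiseMonotone T c) :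
    -- the projection is an isomorphism from the Hofbauer shift onto the Markov part
    IsBorelIsomorphismOn shiftInt shiftInt (hofbauerProj (symbolicDynamics T c))
      (hofbauerShift (symbolicDynamics T c)) (markovPart (symbolicDynamics T c)) ∧
    -- the non-Markov part carries only measures of zero entropy
    CarriesOnlyZeroEntropy shiftInt
      (naturalExtension (symbolicDynamics T c) \ markovPart (symbolicDynamics T c)) ∧
    -- the projection is an entropy-conjugacy
    IsEntropyConjugacy shiftInt shiftInt (hofbauerProj (symbolicDynamics T c))
      (hofbauerShift (symbolicDynamics T c)) (naturalExtension (symbolicDynamics T c)) ∧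
    -- shadowed at all times if and only if non-Markov at all times, up to finitely many sequences
    (kneadingSet T c).Finite ∧
    (∃ E : Set (ℤ → Fin N), E.Finite ∧ E ⊆ naturalExtension (symbolicDynamics T c) ∧
      E ⊆ Function.periodicPts shiftInt ∧
      ∀ A ∈ naturalExtension (symbolicDynamics T c) \ E,
        (∀ p : ℤ, IsShadowedAt (kneadingSet T c) A p) ↔
          (∀ p : ℤ, ¬ IsMarkovAt (symbolicDynamics T c) A p)) ∧
    -- period-preserving bijection between periodic orbits, up to finitely many of them
    (∃ E : Set (ℕ → Fin N), E.Finite ∧ MapsTo shiftNat E E ∧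
      E ⊆ symbolicDynamics T c ∩ Function.periodicPts shiftNat ∧
      BijOn (fun α => tailFrom (hofbauerProj (symbolicDynamics T c) α) 0)
        (hofbauerShift (symbolicDynamics T c) ∩ Function.periodicPts shiftInt)
        ((symbolicDynamics T c ∩ Function.periodicPts shiftNat) \ E) ∧
      ∀ α ∈ hofbauerShift (symbolicDynamics T c) ∩ Function.periodicPts shiftInt,
        Function.minimalPeriod shiftNat (tailFrom (hofbauerProj (symbolicDynamics T c) α) 0) =
          Function.minimalPeriod shiftInt α) := by 
  have hiso := isBorelIsomorphismOn_hofbauerProj (isClosed_symbolicDynamics T c)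
  have hzero := hT.carriesOnlyZeroEntropy
  -- For the entropy-conjugacy nothing is discarded upstairs, and the non-Markov part is discarded
  -- downstairs.
  refine ⟨hiso, hzero, ⟨fun α hα => (hiso.bijOn.mapsTo hα).1, _, Subset.rfl, _, fun A hA => hA.1,
    hiso, by simpa using carriesOnlyZeroEntropy_empty _, hzero⟩, hT.finite_kneadingSet,
    ⟨periodicWithTailIn (symbolicDynamics T c) (kneadingSet T c),
      finite_periodicWithTailIn hT.finite_kneadingSet, fun A hA => hA.1, fun A hA => hA.2.1,
      fun A hA => hT.isShadowedAt_iff hA⟩,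
    ⟨(fun A => tailFrom A 0) '' periodicNonMarkov (symbolicDynamics T c),
      hT.finite_periodicNonMarkov.image _, ?_, ?_, hT.bijOn_periodicPts,
      fun α hα => hT.minimalPeriod_tailFrom_hofbauerProj hα⟩⟩
  · rintro _ ⟨A, hA, rfl⟩
    refine ⟨shiftInt A, shiftInt_mem_periodicNonMarkov hA, ?_⟩
    rw [shiftNat_tailFrom, ← tailFrom_shiftInt]
  · rintro _ ⟨A, hA, rfl⟩
    exact ⟨hA.1.1 0, tailFrom_mem_periodicPts hA.2 0⟩
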